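/- Let $\boldsymbol y\in\mathbb R^3$, $\boldsymbol y\neq 0$, $a=|\boldsymbol y|$, $\hat{\boldsymbol y}=\boldsymbol y/a$. For $\boldsymbol z=\boldsymbol x+i\boldsymbol y\in\mathbb C^3$ let $\gamma(\boldsymbol z)=\sqrt{z_1^2+z_2^2+z_3^2}$ with the branch $\operatorname{Re}\gamma\ge 0$, let $\phi(\boldsymbol z)=-\dfrac1{4\pi\gamma(\boldsymbol z)}$ and, for $\varepsilon>0$, let $\phi_\varepsilon=\theta(\operatorname{Re}\gamma-\varepsilon)\,\phi$, where $\theta$ is the unit step function. A linear functional on $C^1(\mathbb R^3)$ (complex-valued functions, with no condition on the support) is called bounded if, for some compact $K\subset\mathbb R^3$ and some constant $C$, its value at each $f$ is at most $C\sup_K\max(|f|,\|Df\|)$ in modulus. For each $\varepsilon>0$ the distributional Laplacian (in $\boldsymbol x$) $\tilde\delta_\varepsilon=\Delta\phi_\varepsilon$ extends to a bounded linear functional on $C^1(\mathbb R^3)$, and the limit $\langle\tilde\delta,f\rangle=\lim_{\varepsilon\to0^+}\langle\tilde\delta_\varepsilon,f\rangle$ exists for every $f\in C^1(\mathbb R^3)$.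 The functional $\tilde\delta=\tilde\delta(\boldsymbol x+i\boldsymbol y)$ so defined (the singular source distribution) is unique, it is a bounded linear functional on $C^1(\mathbb R^3)$, and on $C_c^\infty(\mathbb R^3)$ it is the distributional Laplacian $-\Delta\dfrac1{4\pi\gamma}$ of the locally integrable function $\phi$. Let $\boldsymbol e_1,\boldsymbol e_2,\hat{\boldsymbol y}$ be an orthonormal basis of $\mathbb R^3$. For $f\in C^1(\mathbb R^3)$ let $$\bar f(\rho,\zeta)=\frac1{2\pi}\int_0^{2\pi}f\big(\rho(\cos\theta\,\boldsymbol e_1+\sin\theta\,\boldsymbol e_2)+\zeta\hat{\boldsymbol y}\big)\,d\theta,$$ the mean of $f$ over the circle with cylindrical coordinates $(\rho,\zeta)$, and let $$\bar f^{\sharp}(p,q)=\bar f\Big(\tfrac1a\sqrt{a^2+p^2}\sqrt{a^2-q^2},\ \tfrac{pq}a\Big)$$ be the same mean in oblate spheroidal coordinates. Then $$\langle\tilde\delta,f\rangle=L_0+L_1+iL_2,$$ where $$L_0=\bar f^\sharp(0,0)=\bar f(a,0),$$ $$L_1=-a\int_0^a\frac{\bar f^\sharp(0,q)-\bar f^\sharp(0,0)}{q^2}\,dq=-a\int_0^a\frac{\bar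 f(\rho,0)-\bar f(a,0)}{(a^2-\rho^2)^{3/2}}\,\rho\,d\rho,$$ $$L_2=-a\int_0^a\frac{\partial_p\bar f^\sharp(0,q)}{q}\,dq=-\int_0^a\frac{\partial_\zeta\bar f(\rho,0)}{\sqrt{a^2-\rho^2}}\,\rho\,d\rho,$$ the partial derivatives exist for $0<q<a$, resp. $0<\rho<a$, and all the integrals converge absolutely. -/

import Mathlib

open MeasureTheory Filter Set Topology
open scoped ContDiff Laplacian

noncomputable section

namespace HoloPotential

/-- Real Euclidean three-space. -/
abbrev R3 : Type := EuclideanSpace ℝ (Fin 3)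

/-- The point `x + i y` of `ℂ³`. -/
def toC3 (x y : R3) : Fin 3 → ℂ := fun j => (x j : ℂ) + Complex.I * (y j : ℂ)

/-- The complex distance `γ(z) = √(z₁² + z₂² + z₃²)` on `ℂ³`, on the branch `Re γ ≥ 0`. -/
def gam (z : Fin 3 → ℂ) : ℂ := Complex.sqrt (∑ j, z j ^ 2)

/-- The holomorphic potential `φ(x + i y) = -1 / (4 π γ(x + i y))` as a function of `x`. -/
def phi (y x : R3) : ℂ := -1 / (4 * (Real.pi : ℂ) * gam (toC3 x y))

open Classical in
/-- The regularized potential `φ_ε = θ(Re γ - ε) φ`, with `θ` the unit step function. -/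
def phiReg (ε : ℝ) (y x : R3) : ℂ := if ε < (gam (toC3 x y)).re then phi y x else 0

/-- The space `C¹(ℝ³)` of complex-valued test functions (no decay or support condition). -/
def C1 : Submodule ℂ (R3 → ℂ) where
  carrier := {f | ContDiff ℝ 1 f}
  add_mem' {f g} (hf : ContDiff ℝ 1 f) (hg : ContDiff ℝ 1 g) := hf.add hg
  zero_mem' := (contDiff_const : ContDiff ℝ 1 fun _ : R3 => (0 : ℂ))
  smul_mem' c f (hf : ContDiff ℝ 1 f) := hf.const_smul c

/-- Boundedness of a linear functional on `C¹(ℝ³)`: for some compact `K` and constant `C`, the value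
at `f` is at most `C` times any common bound on `K` of `f` and its first derivative. -/
def IsBoundedC1 (T : C1 →ₗ[ℂ] ℂ) : Prop :=
  ∃ K : Set R3, IsCompact K ∧ ∃ C : ℝ, ∀ (f : C1) (M : ℝ), 0 ≤ M →
    (∀ x ∈ K, ‖(f : R3 → ℂ) x‖ ≤ M ∧ ‖fderiv ℝ (f : R3 → ℂ) x‖ ≤ M) → ‖T f‖ ≤ C * M

/-- `T` is the distributional Laplacian `Δu` of the locally integrable function `u`, as a bounded
linear functional on `C¹(ℝ³)`: on `f ∈ C_c^∞(ℝ³)` it is `∫ u Δf`. -/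
def IsDistribLaplacian (u : R3 → ℂ) (T : C1 →ₗ[ℂ] ℂ) : Prop :=
  LocallyIntegrable u volume ∧ IsBoundedC1 T ∧
    ∀ f : C1, ContDiff ℝ ∞ (f : R3 → ℂ) → HasCompactSupport (f : R3 → ℂ) →
      T f = ∫ x, u x * Δ (f : R3 → ℂ) x

/-- `T` is the singular source distribution `x ↦ δ̃(x + i y)`: the limit as `ε → 0⁺`, on every `C¹`
test function, of the regularized source distributions `δ̃_ε = Δ φ_ε`. -/
def IsSingularSource (y : R3) (T : C1 →ₗ[ℂ] ℂ) : Prop :=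
  ∃ S : ℝ → (C1 →ₗ[ℂ] ℂ), (∀ ε, 0 < ε → IsDistribLaplacian (phiReg ε y) (S ε)) ∧
    ∀ f : C1, Tendsto (fun ε => S ε f) (𝓝[>] 0) (𝓝 (T f))

/-- The mean `f̄(ρ, ζ)` of `f` over the circle of radius `ρ` centred at `ζ n` in the plane through
`ζ n` parallel to the orthonormal vectors `e₁`, `e₂`. -/
def cylMean (e₁ e₂ n : R3) (f : R3 → ℂ) (ρ ζ : ℝ) : ℂ :=
  (1 / (2 * Real.pi) : ℝ) *
    ∫ θ in (0 : ℝ)..(2 * Real.pi), f (ρ • (Real.cos θ • e₁ + Real.sin θ • e₂) + ζ • n)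

/-- The same mean in oblate spheroidal coordinates `(p, q)`, where
`ρ = √(a² + p²) √(a² - q²) / a` and `ζ = p q / a`. -/
def oblMean (a : ℝ) (e₁ e₂ n : R3) (f : R3 → ℂ) (p q : ℝ) : ℂ :=
  cylMean e₁ e₂ n f (√(a ^ 2 + p ^ 2) * √(a ^ 2 - q ^ 2) / a) (p * q / a)

/-- The partial derivative `∂f̄/∂p` in oblate spheroidal coordinates. -/
def oblMeanP (a : ℝ) (e₁ e₂ n : R3) (f : R3 → ℂ) (p q : ℝ) : ℂ :=
  deriv (fun s => oblMean a e₁ e₂ n f s q) p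

/-- The partial derivative `∂f̄/∂ζ` in cylindrical coordinates. -/
def cylMeanZ (e₁ e₂ n : R3) (f : R3 → ℂ) (ρ ζ : ℝ) : ℂ :=
  deriv (fun s => cylMean e₁ e₂ n f ρ s) ζ

/-- `L₀ = f̄`, evaluated on the rim circle: oblate spheroidal form. -/
def L0obl (a : ℝ) (e₁ e₂ n : R3) (f : R3 → ℂ) : ℂ := oblMean a e₁ e₂ n f 0 0

/-- `L₀`, cylindrical form. -/
def L0cyl (a : ℝ) (e₁ e₂ n : R3) (f : R3 → ℂ) : ℂ := cylMean e₁ e₂ n f a 0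

/-- The integrand of `L₁`, oblate spheroidal form. -/
def k1obl (a : ℝ) (e₁ e₂ n : R3) (f : R3 → ℂ) (q : ℝ) : ℂ :=
  (oblMean a e₁ e₂ n f 0 q - oblMean a e₁ e₂ n f 0 0) / (q : ℂ) ^ 2

/-- The integrand of `L₁`, cylindrical form. -/
def k1cyl (a : ℝ) (e₁ e₂ n : R3) (f : R3 → ℂ) (ρ : ℝ) : ℂ :=
  (cylMean e₁ e₂ n f ρ 0 - cylMean e₁ e₂ n f a 0) /
    (((a ^ 2 - ρ ^ 2) ^ (3 / 2 : ℝ) : ℝ) : ℂ) * (ρ : ℂ)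

/-- The integrand of `L₂`, oblate spheroidal form. -/
def k2obl (a : ℝ) (e₁ e₂ n : R3) (f : R3 → ℂ) (q : ℝ) : ℂ :=
  oblMeanP a e₁ e₂ n f 0 q / (q : ℂ)

/-- The integrand of `L₂`, cylindrical form. -/
def k2cyl (a : ℝ) (e₁ e₂ n : R3) (f : R3 → ℂ) (ρ : ℝ) : ℂ :=
  cylMeanZ e₁ e₂ n f ρ 0 / ((√(a ^ 2 - ρ ^ 2) : ℝ) : ℂ) * (ρ : ℂ)

/-- `L₁`, oblate spheroidal form. -/
def L1obl (a : ℝ) (e₁ e₂ n : R3) (f : R3 → ℂ) : ℂ :=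
  -(a : ℂ) * ∫ q in (0 : ℝ)..a, k1obl a e₁ e₂ n f q

/-- `L₁`, cylindrical form. -/
def L1cyl (a : ℝ) (e₁ e₂ n : R3) (f : R3 → ℂ) : ℂ :=
  -(a : ℂ) * ∫ ρ in (0 : ℝ)..a, k1cyl a e₁ e₂ n f ρ

/-- `L₂`, oblate spheroidal form. -/
def L2obl (a : ℝ) (e₁ e₂ n : R3) (f : R3 → ℂ) : ℂ :=
  -(a : ℂ) * ∫ q in (0 : ℝ)..a, k2obl a e₁ e₂ n f q

/-- `L₂`, cylindrical form. -/
def L2cyl (a : ℝ) (e₁ e₂ n : R3) (f : R3 → ℂ) : ℂ :=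
  -∫ ρ in (0 : ℝ)..a, k2cyl a e₁ e₂ n f ρ

end HoloPotential

end

open HoloPotential

/-! With p = a sinh s and q = a sin τ, the complex distance is γ = p + iq = a w, where w = sinh s +
i sin τ, and (s, τ) ↦ (ρ, ζ) is conformal with Jacobian |γ|². The surface Re γ = ε is the spheroid s
= arsinh(ε/a), which collapses onto the disk ρ ≤ a, ζ = 0 as ε → 0. Outside it φ is smooth and
harmonic, so Green's formula (`integral_phiReg_mul_laplacian`) turns ∫ φ_ε Δf into a flux through
the spheroid. With G the circle mean of f, this flux is ½ ∫ (cosh s cos τ / w · ∂_s G + cosh² s cos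
τ / w² · G) dτ over |τ| ≤ π/2. Only first derivatives of f occur, whence the extension to C¹.

As s → 0 the second kernel becomes non-integrable at τ = 0, the rim. But its integral equals 2 for
every s > 0 (`integral_kernel`), so subtracting the rim value G(a, 0) inside the integral costs
exactly G(a, 0) = L₀. What is left is bounded uniformly in s (`norm_fluxReg_le`), because the
distance of (ρ, ζ) to the rim is O(|w|²) and ∂_s(ρ, ζ) is O(|w|). Dominated convergence
(`tendsto_surf`) then gives the integrand at s = 0, -cos τ (G(a cos τ, 0) - G(a, 0)) / sin² τ - i a
cos τ ∂_ζ G(a cos τ, 0), which is even in τ. The substitutions q = a sin τ and ρ = a cos τ produce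
the two forms of L₁ and L₂.

The flux estimate bounds the regularized functionals uniformly for small ε, hence also their limit.
Bounded functionals are determined by their values on C_c^∞, which is dense in C¹ on compact sets
(`exists_contDiff_approx`); this gives uniqueness and independence of the frame. Finally φ is
locally integrable, since the Jacobian |γ|² absorbs 1/γ, and dominated convergence in ∫ φ_ε Δf
identifies the limit with Δφ. -/

namespace HoloPotential

/-! ### Smoothness of integrals depending on a parameter -/

section ParametricIntegrals

theorem hasFDerivAt_intervalIntegral_of_contDiff {V E : Type} [NormedAddCommGroup V]
    [NormedSpace ℝ V] [ProperSpace V] [NormedAddCommGroup E] [NormedSpace ℝ E] [CompleteSpace E]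
    {k : V × ℝ → E} (hk : ContDiff ℝ 1 k) (a b : ℝ) (v : V) :
    HasFDerivAt (fun v => ∫ θ in a..b, k (v, θ))
      (∫ θ in a..b, (fderiv ℝ k (v, θ)).comp (ContinuousLinearMap.inl ℝ V ℝ)) v := by
  have hc : Continuous fun p : V × ℝ => (fderiv ℝ k p).comp (ContinuousLinearMap.inl ℝ V ℝ) :=
    (hk.continuous_fderiv one_ne_zero).clm_comp continuous_const
  -- Properness makes the ball compact, so a constant dominates the derivative near `v`.
  obtain ⟨C, hC⟩ := ((isCompact_closedBall v 1).prod (isCompact_uIcc (a := a) (b := b))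
    ).exists_bound_of_continuousOn hc.continuousOn
  refine intervalIntegral.hasFDerivAt_integral_of_dominated_of_fderiv_le (𝕜 := ℝ)
    (s := Metric.closedBall v 1) (bound := fun _ => C)
    (F' := fun v θ => (fderiv ℝ k (v, θ)).comp (ContinuousLinearMap.inl ℝ V ℝ))
    (Metric.closedBall_mem_nhds v one_pos) ?_ ?_ ?_ ?_ intervalIntegrable_const ?_
  · exact Eventually.of_forall fun x =>
      (hk.continuous.comp (Continuous.prodMk_right x)).aestronglyMeasurable
  · exact (hk.continuous.comp (Continuous.prodMk_right v)).intervalIntegrable _ _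
  · exact (hc.comp (Continuous.prodMk_right v)).aestronglyMeasurable
  · exact Eventually.of_forall fun t ht x hx => hC (x, t) ⟨hx, uIoc_subset_uIcc ht⟩
  · refine Eventually.of_forall fun t _ x _ => ?_
    exact ((hk.differentiable one_ne_zero (x, t)).hasFDerivAt).comp x
      (hasFDerivAt_prodMk_left x t)

/-- The codomain is quantified inside the induction because the derivative is again such an
integral, with values in `V →L[ℝ] E`. -/
theorem contDiff_intervalIntegral {V : Type} [NormedAddCommGroup V]
    [NormedSpace ℝ V] [ProperSpace V] (a b : ℝ) (n : ℕ) :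
    ∀ {E : Type} [NormedAddCommGroup E] [NormedSpace ℝ E] [CompleteSpace E]
      {k : V × ℝ → E}, ContDiff ℝ n k → ContDiff ℝ n fun v => ∫ θ in a..b, k (v, θ) := by
  induction n with
  | zero =>
    intro E _ _ _ k hk
    have hk : Continuous k := hk.continuous
    refine contDiff_zero.2 ?_
    exact intervalIntegral.continuous_parametric_intervalIntegral_of_continuous'
      (f := fun v θ => k (v, θ)) hk a b
  | succ n ih =>
    intro E _ _ _ k hk
    have hk1 : ContDiff ℝ 1 k := hk.of_le (by norm_cast; omega)
    refine contDiff_succ_iff_hasFDerivAt.2 ⟨_, ?_,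
      fun v => hasFDerivAt_intervalIntegral_of_contDiff hk1 a b v⟩
    refine ih (k := fun p => (fderiv ℝ k p).comp (ContinuousLinearMap.inl ℝ V ℝ)) ?_
    exact (hk.fderiv_right (m := (n : ℕ∞ω)) (by norm_cast)).clm_comp contDiff_const

end ParametricIntegrals

/-! ### Circle means and the Laplacian in cylindrical coordinates -/

section CircleMeans

/-- The radial unit vector at angle `θ`. -/
noncomputable def radial (e₁ e₂ : R3) (θ : ℝ) : R3 := Real.cos θ • e₁ + Real.sin θ • e₂

/-- The angular unit vector at angle `θ`. -/
noncomputable def angular (e₁ e₂ : R3) (θ : ℝ) : R3 := -Real.sin θ • e₁ + Real.cos θ • e₂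

/-- The point with cylindrical coordinates `(ρ, θ, ζ)`, as a linear function of `(ρ, ζ)`. -/
noncomputable def cylPoint (e₁ e₂ n : R3) (θ : ℝ) : ℝ × ℝ →L[ℝ] R3 :=
  (ContinuousLinearMap.fst ℝ ℝ ℝ).smulRight (radial e₁ e₂ θ) +
    (ContinuousLinearMap.snd ℝ ℝ ℝ).smulRight n

/-- The circle mean as a function of the pair `(ρ, ζ)`. -/
noncomputable def meanFn (e₁ e₂ n : R3) (f : R3 → ℂ) (v : ℝ × ℝ) : ℂ := cylMean e₁ e₂ n f v.1 v.2

theorem cylPoint_apply (e₁ e₂ n : R3) (θ : ℝ) (v : ℝ × ℝ) :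
    cylPoint e₁ e₂ n θ v = v.1 • radial e₁ e₂ θ + v.2 • n := rfl

theorem hasDerivAt_radial (e₁ e₂ : R3) (θ : ℝ) :
    HasDerivAt (radial e₁ e₂) (angular e₁ e₂ θ) θ := by
  exact ((Real.hasDerivAt_cos θ).smul_const e₁).add ((Real.hasDerivAt_sin θ).smul_const e₂)

theorem hasDerivAt_angular (e₁ e₂ : R3) (θ : ℝ) :
    HasDerivAt (angular e₁ e₂) (-radial e₁ e₂ θ) θ := by
  have := ((Real.hasDerivAt_sin θ).neg.smul_const e₁).add
    ((Real.hasDerivAt_cos θ).smul_const e₂)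
  refine this.congr_deriv ?_
  simp only [radial]
  module

theorem contDiff_radial (e₁ e₂ : R3) {m : ℕ∞ω} : ContDiff ℝ m (radial e₁ e₂) :=
  (Real.contDiff_cos.smul contDiff_const).add (Real.contDiff_sin.smul contDiff_const)

theorem continuous_angular (e₁ e₂ : R3) : Continuous (angular e₁ e₂) := by
  unfold angular
  fun_prop

theorem contDiff_cylPoint (e₁ e₂ n : R3) {m : ℕ∞ω} :
    ContDiff ℝ m fun p : (ℝ × ℝ) × ℝ => cylPoint e₁ e₂ n p.2 p.1 := by
  simp only [cylPoint_apply]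
  exact ((contDiff_fst.comp contDiff_fst).smul ((contDiff_radial e₁ e₂).comp contDiff_snd)).add
    ((contDiff_snd.comp contDiff_fst).smul contDiff_const)

theorem contDiff_cylPoint_angle (e₁ e₂ n : R3) (v : ℝ × ℝ) {m : ℕ∞ω} :
    ContDiff ℝ m fun θ => cylPoint e₁ e₂ n θ v := by
  simp only [cylPoint_apply]
  exact ((contDiff_radial e₁ e₂).const_smul v.1).add contDiff_const

theorem meanFn_eq (e₁ e₂ n : R3) (f : R3 → ℂ) (v : ℝ × ℝ) :
    meanFn e₁ e₂ n f v =
      (1 / (2 * Real.pi) : ℝ) • ∫ θ in (0 : ℝ)..(2 * Real.pi), f (cylPoint e₁ e₂ n θ v) := by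
  simp only [meanFn, cylMean, Complex.real_smul]
  rfl

theorem contDiff_meanFn (e₁ e₂ n : R3) {f : R3 → ℂ} {m : ℕ} (hf : ContDiff ℝ m f) :
    ContDiff ℝ m (meanFn e₁ e₂ n f) := by
  have h := contDiff_intervalIntegral 0 (2 * Real.pi) m
    (hf.comp (contDiff_cylPoint e₁ e₂ n (m := m)))
  have h2 := h.const_smul (1 / (2 * Real.pi) : ℝ)
  rwa [funext (meanFn_eq e₁ e₂ n f)]

/-- The integrand may depend on θ beyond the point, so that the formula also applies to the first
derivative of a mean, where the direction of differentiation turns with θ. -/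
theorem fderiv_intervalIntegral_cylPoint (e₁ e₂ n : R3) {F : R3 × ℝ → ℂ} (hF : ContDiff ℝ 1 F)
    (v : ℝ × ℝ) (w : ℝ × ℝ) :
    fderiv ℝ (fun v => ∫ θ in (0 : ℝ)..(2 * Real.pi), F (cylPoint e₁ e₂ n θ v, θ)) v w =
      ∫ θ in (0 : ℝ)..(2 * Real.pi),
        fderiv ℝ (fun x => F (x, θ)) (cylPoint e₁ e₂ n θ v) (cylPoint e₁ e₂ n θ w) := by
  have hk : ContDiff ℝ 1 fun p : (ℝ × ℝ) × ℝ => F (cylPoint e₁ e₂ n p.2 p.1, p.2) :=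
    hF.comp ((contDiff_cylPoint e₁ e₂ n).prodMk contDiff_snd)
  have hc : Continuous fun p : (ℝ × ℝ) × ℝ =>
      (fderiv ℝ (fun p : (ℝ × ℝ) × ℝ => F (cylPoint e₁ e₂ n p.2 p.1, p.2)) p).comp
        (ContinuousLinearMap.inl ℝ (ℝ × ℝ) ℝ) :=
    (hk.continuous_fderiv one_ne_zero).clm_comp continuous_const
  have hi := (hc.comp (Continuous.prodMk_right v)).intervalIntegrable (μ := volume)
    0 (2 * Real.pi)
  rw [(hasFDerivAt_intervalIntegral_of_contDiff hk 0 (2 * Real.pi) v).fderiv]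
  refine (ContinuousLinearMap.intervalIntegral_apply hi w).trans ?_
  refine intervalIntegral.integral_congr fun θ _ => ?_
  have h1 : HasFDerivAt (fun v => F (cylPoint e₁ e₂ n θ v, θ))
      ((fderiv ℝ (fun p : (ℝ × ℝ) × ℝ => F (cylPoint e₁ e₂ n p.2 p.1, p.2)) (v, θ)).comp
        (ContinuousLinearMap.inl ℝ (ℝ × ℝ) ℝ)) v :=
    HasFDerivAt.comp (f := fun u : ℝ × ℝ => (u, θ))
      (g := fun p : (ℝ × ℝ) × ℝ => F (cylPoint e₁ e₂ n p.2 p.1, p.2)) v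
      (hk.differentiable one_ne_zero (v, θ)).hasFDerivAt (hasFDerivAt_prodMk_left v θ)
  have hd : Differentiable ℝ fun x => F (x, θ) :=
    (hF.differentiable one_ne_zero).comp
      (differentiable_id.prodMk (differentiable_const θ))
  have h2 : HasFDerivAt (fun v => F (cylPoint e₁ e₂ n θ v, θ))
      ((fderiv ℝ (fun x => F (x, θ)) (cylPoint e₁ e₂ n θ v)).comp (cylPoint e₁ e₂ n θ)) v :=
    (hd _).hasFDerivAt.comp v (cylPoint e₁ e₂ n θ).hasFDerivAt
  exact congrArg (fun L => L w) (h1.unique h2)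

theorem fderiv_meanFn (e₁ e₂ n : R3) {f : R3 → ℂ} (hf : ContDiff ℝ 1 f) (v w : ℝ × ℝ) :
    fderiv ℝ (meanFn e₁ e₂ n f) v w =
      (1 / (2 * Real.pi) : ℝ) • ∫ θ in (0 : ℝ)..(2 * Real.pi),
        fderiv ℝ f (cylPoint e₁ e₂ n θ v) (cylPoint e₁ e₂ n θ w) := by
  have h := fderiv_intervalIntegral_cylPoint e₁ e₂ n (F := fun p => f p.1)
    (hf.comp contDiff_fst) v w
  have hd : DifferentiableAt ℝ
      (fun v => ∫ θ in (0 : ℝ)..(2 * Real.pi), f (cylPoint e₁ e₂ n θ v)) v :=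
    (contDiff_intervalIntegral 0 (2 * Real.pi) 1
      (hf.comp (contDiff_cylPoint e₁ e₂ n (m := 1)))).differentiable (by simp) v
  rw [funext (meanFn_eq e₁ e₂ n f), fderiv_fun_const_smul hd]
  simp only [smul_apply]
  rw [h]

theorem norm_smul_integral_le {g : ℝ → ℂ} {M : ℝ} (hg : ∀ θ, ‖g θ‖ ≤ M) :
    ‖(1 / (2 * Real.pi) : ℝ) • ∫ θ in (0 : ℝ)..(2 * Real.pi), g θ‖ ≤ M := by
  have h := intervalIntegral.norm_integral_le_of_norm_le_const
    (a := 0) (b := 2 * Real.pi) (f := g) (C := M) fun θ _ => hg θ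
  have hp := Real.pi_pos
  rw [norm_smul, Real.norm_of_nonneg (by positivity)]
  rw [sub_zero, abs_of_pos (by positivity)] at h
  calc _ ≤ 1 / (2 * Real.pi) * (M * (2 * Real.pi)) := by gcongr
    _ = M := by field_simp

theorem norm_radial {e₁ e₂ n : R3} (he : Orthonormal ℝ ![e₁, e₂, n]) (θ : ℝ) :
    ‖radial e₁ e₂ θ‖ = 1 := by
  have h1 : inner ℝ e₁ e₁ = (1 : ℝ) := by
    simpa using (orthonormal_iff_ite.1 he 0 0)
  have h2 : inner ℝ e₂ e₂ = (1 : ℝ) := by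
    simpa using (orthonormal_iff_ite.1 he 1 1)
  have h3 : inner ℝ e₁ e₂ = (0 : ℝ) := by
    simpa using (orthonormal_iff_ite.1 he 0 1)
  have h4 : inner ℝ e₂ e₁ = (0 : ℝ) := by
    simpa using (orthonormal_iff_ite.1 he 1 0)
  have : ‖radial e₁ e₂ θ‖ ^ 2 = 1 := by
    rw [← real_inner_self_eq_norm_sq]
    simp only [radial, inner_add_left, inner_add_right, inner_smul_left, inner_smul_right, h1, h2,
      h3, h4]
    simp only [conj_trivial]
    nlinarith [Real.sin_sq_add_cos_sq θ]
  nlinarith [norm_nonneg (radial e₁ e₂ θ)]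

/-- The factor 2 comes from the sup norm on `ℝ × ℝ`; it is the source of the radii `2 * R` and of
the derivative bound `2 * M`. -/
theorem norm_cylPoint_le {e₁ e₂ n : R3} (he : Orthonormal ℝ ![e₁, e₂, n]) (θ : ℝ) (v : ℝ × ℝ) :
    ‖cylPoint e₁ e₂ n θ v‖ ≤ 2 * ‖v‖ := by
  have hn : ‖n‖ = 1 := by simpa using he.1 2
  have h := norm_add_le (v.1 • radial e₁ e₂ θ) (v.2 • n)
  rw [norm_smul, norm_smul, norm_radial he, hn, mul_one, mul_one] at h
  rw [cylPoint_apply]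
  linarith [norm_fst_le v, norm_snd_le v]

theorem norm_meanFn_le {e₁ e₂ n : R3} (he : Orthonormal ℝ ![e₁, e₂, n]) {f : R3 → ℂ} {M R : ℝ}
    (hM : ∀ x ∈ Metric.closedBall (0 : R3) (2 * R), ‖f x‖ ≤ M) {v : ℝ × ℝ} (hv : ‖v‖ ≤ R) :
    ‖meanFn e₁ e₂ n f v‖ ≤ M := by
  rw [meanFn_eq]
  refine norm_smul_integral_le fun θ => hM _ ?_
  rw [mem_closedBall_zero_iff]
  linarith [norm_cylPoint_le he θ v]

theorem norm_fderiv_meanFn_le {e₁ e₂ n : R3} (he : Orthonormal ℝ ![e₁, e₂, n]) {f : R3 → ℂ}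
    (hf : ContDiff ℝ 1 f) {M R : ℝ} (hM0 : 0 ≤ M)
    (hM : ∀ x ∈ Metric.closedBall (0 : R3) (2 * R), ‖fderiv ℝ f x‖ ≤ M) {v : ℝ × ℝ}
    (hv : ‖v‖ ≤ R) :
    ‖fderiv ℝ (meanFn e₁ e₂ n f) v‖ ≤ 2 * M := by
  refine ContinuousLinearMap.opNorm_le_bound _ (by positivity) fun w => ?_
  rw [fderiv_meanFn e₁ e₂ n hf]
  refine norm_smul_integral_le fun θ => ?_
  have h1 : ‖fderiv ℝ f (cylPoint e₁ e₂ n θ v)‖ ≤ M := by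
    refine hM _ ?_
    rw [mem_closedBall_zero_iff]
    linarith [norm_cylPoint_le he θ v]
  refine ((fderiv ℝ f _).le_opNorm _).trans ?_
  have := mul_le_mul h1 (norm_cylPoint_le he θ w) (norm_nonneg _) hM0
  linarith

theorem exists_orthonormalBasis_eq {e₁ e₂ n : R3} (he : Orthonormal ℝ ![e₁, e₂, n]) :
    ∃ b : OrthonormalBasis (Fin 3) ℝ R3, b 0 = e₁ ∧ b 1 = e₂ ∧ b 2 = n := by
  have hv : Orthonormal ℝ ((univ : Set (Fin 3)).domRestrict ![e₁, e₂, n]) :=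
    he.comp _ Subtype.val_injective
  obtain ⟨b, hb⟩ := hv.exists_orthonormalBasis_extension_of_card_eq (by simp)
  exact ⟨b, hb 0 (mem_univ _), hb 1 (mem_univ _), hb 2 (mem_univ _)⟩

theorem laplacian_eq_of_orthonormal {e₁ e₂ n : R3} (he : Orthonormal ℝ ![e₁, e₂, n])
    (f : R3 → ℂ) (x : R3) :
    Δ f x = fderiv ℝ (fderiv ℝ f) x e₁ e₁ + fderiv ℝ (fderiv ℝ f) x e₂ e₂ +
      fderiv ℝ (fderiv ℝ f) x n n := by
  obtain ⟨b, h0, h1, h2⟩ := exists_orthonormalBasis_eq he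
  rw [InnerProductSpace.laplacian_eq_iteratedFDeriv_orthonormalBasis f b]
  simp [Fin.sum_univ_three, iteratedFDeriv_two_apply, h0, h1, h2]

theorem contDiff_one_fderiv {f : R3 → ℂ} (hf : ContDiff ℝ 2 f) : ContDiff ℝ 1 (fderiv ℝ f) :=
  hf.fderiv_right one_add_one_eq_two.le

theorem fderiv_fderiv_apply_const {f : R3 → ℂ} (hf : ContDiff ℝ 2 f) (x a b : R3) :
    fderiv ℝ (fun x => fderiv ℝ f x b) x a = fderiv ℝ (fderiv ℝ f) x a b := by
  have hd : DifferentiableAt ℝ (fderiv ℝ f) x :=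
    (contDiff_one_fderiv hf).differentiable one_ne_zero x
  rw [fderiv_clm_apply hd (differentiableAt_const b)]
  simp

theorem fderiv_fderiv_meanFn (e₁ e₂ n : R3) {f : R3 → ℂ} (hf : ContDiff ℝ 2 f) (v u w : ℝ × ℝ) :
    fderiv ℝ (fun v => fderiv ℝ (meanFn e₁ e₂ n f) v u) v w =
      (1 / (2 * Real.pi) : ℝ) • ∫ θ in (0 : ℝ)..(2 * Real.pi),
        fderiv ℝ (fderiv ℝ f) (cylPoint e₁ e₂ n θ v) (cylPoint e₁ e₂ n θ w)
          (cylPoint e₁ e₂ n θ u) := by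
  have hf1 : ContDiff ℝ 1 f := hf.of_le one_le_two
  have hF : ContDiff ℝ 1 fun p : R3 × ℝ => fderiv ℝ f p.1 (cylPoint e₁ e₂ n p.2 u) :=
    ((contDiff_one_fderiv hf).comp contDiff_fst).clm_apply
      ((contDiff_cylPoint_angle e₁ e₂ n u).comp contDiff_snd)
  have hd : DifferentiableAt ℝ
      (fun v => ∫ θ in (0 : ℝ)..(2 * Real.pi),
        fderiv ℝ f (cylPoint e₁ e₂ n θ v) (cylPoint e₁ e₂ n θ u)) v :=
    (contDiff_intervalIntegral 0 (2 * Real.pi) 1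
      (k := fun p => fderiv ℝ f (cylPoint e₁ e₂ n p.2 p.1) (cylPoint e₁ e₂ n p.2 u))
      (hF.comp ((contDiff_cylPoint e₁ e₂ n).prodMk contDiff_snd))).differentiable (by simp) v
  have h := fderiv_intervalIntegral_cylPoint e₁ e₂ n hF v w
  simp only [fderiv_meanFn e₁ e₂ n hf1]
  rw [fderiv_fun_const_smul hd, smul_apply, h]
  simp only [fderiv_fderiv_apply_const hf]

/-- The integrand is the θ-derivative of the 2π-periodic function Df applied to the angular vector.
It trades the angular second derivative for the first-order radial term of the Laplacian. -/
theorem integral_angular_eq_zero (e₁ e₂ n : R3) {f : R3 → ℂ} (hf : ContDiff ℝ 2 f) (v : ℝ × ℝ) :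
    ∫ θ in (0 : ℝ)..(2 * Real.pi),
      ((v.1 : ℂ) * fderiv ℝ (fderiv ℝ f) (cylPoint e₁ e₂ n θ v) (angular e₁ e₂ θ)
        (angular e₁ e₂ θ) - fderiv ℝ f (cylPoint e₁ e₂ n θ v) (radial e₁ e₂ θ)) = 0 := by
  have hf' : ContDiff ℝ 1 (fderiv ℝ f) := contDiff_one_fderiv hf
  have hcyl : Continuous fun θ => cylPoint e₁ e₂ n θ v :=
    (contDiff_cylPoint_angle e₁ e₂ n v (m := 0)).continuous
  have hrad : Continuous (radial e₁ e₂) := (contDiff_radial e₁ e₂ (m := 0)).continuous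
  have hang := continuous_angular e₁ e₂
  have hc1 := hf'.continuous
  have hc2 := hf'.continuous_fderiv one_ne_zero
  have hder : ∀ θ : ℝ, HasDerivAt
      (fun θ => fderiv ℝ f (cylPoint e₁ e₂ n θ v) (angular e₁ e₂ θ))
      ((v.1 : ℂ) * fderiv ℝ (fderiv ℝ f) (cylPoint e₁ e₂ n θ v) (angular e₁ e₂ θ)
        (angular e₁ e₂ θ) - fderiv ℝ f (cylPoint e₁ e₂ n θ v) (radial e₁ e₂ θ)) θ := by
    intro θ
    have h1 : HasDerivAt (fun θ => cylPoint e₁ e₂ n θ v) (v.1 • angular e₁ e₂ θ) θ := by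
      simp only [cylPoint_apply]
      simpa using ((hasDerivAt_radial e₁ e₂ θ).const_smul v.1).add_const (v.2 • n)
    have h2 := ((hf'.differentiable one_ne_zero _).hasFDerivAt.comp_hasDerivAt θ h1).clm_apply
      (hasDerivAt_angular e₁ e₂ θ)
    refine h2.congr_deriv ?_
    simp [sub_eq_add_neg]
  rw [intervalIntegral.integral_eq_sub_of_hasDerivAt (fun θ _ => hder θ)]
  · simp [radial, angular, cylPoint_apply]
  · refine Continuous.intervalIntegrable ?_ _ _
    fun_prop

/-- The Laplacian is the trace of the Hessian in the rotating frame (radial, angular, axial), and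
the angular entry is removed by `integral_angular_eq_zero`. The factor ρ keeps the identity free of
division on the axis; it is also the factor supplied by the volume element. -/
theorem mul_meanFn_laplacian {e₁ e₂ n : R3} (he : Orthonormal ℝ ![e₁, e₂, n]) {f : R3 → ℂ}
    (hf : ContDiff ℝ 2 f) (v : ℝ × ℝ) :
    (v.1 : ℂ) * meanFn e₁ e₂ n (Δ f) v =
      (v.1 : ℂ) * (fderiv ℝ (fun v => fderiv ℝ (meanFn e₁ e₂ n f) v (1, 0)) v (1, 0) +
        fderiv ℝ (fun v => fderiv ℝ (meanFn e₁ e₂ n f) v (0, 1)) v (0, 1)) +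
      fderiv ℝ (meanFn e₁ e₂ n f) v (1, 0) := by
  have hf1 : ContDiff ℝ 1 f := hf.of_le one_le_two
  have hf' : ContDiff ℝ 1 (fderiv ℝ f) := contDiff_one_fderiv hf
  have hcyl : Continuous fun θ => cylPoint e₁ e₂ n θ v :=
    (contDiff_cylPoint_angle e₁ e₂ n v (m := 0)).continuous
  have hrad : Continuous (radial e₁ e₂) := (contDiff_radial e₁ e₂ (m := 0)).continuous
  have hang := continuous_angular e₁ e₂
  have hc1 := hf'.continuous
  have hc2 := hf'.continuous_fderiv one_ne_zero
  have hr : ∀ θ, cylPoint e₁ e₂ n θ (1, 0) = radial e₁ e₂ θ := fun θ => by simp [cylPoint_apply]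
  have hn : ∀ θ, cylPoint e₁ e₂ n θ (0, 1) = n := fun θ => by simp [cylPoint_apply]
  rw [fderiv_fderiv_meanFn e₁ e₂ n hf, fderiv_fderiv_meanFn e₁ e₂ n hf,
    fderiv_meanFn e₁ e₂ n hf1, meanFn_eq]
  simp only [hr, hn]
  have h0 := integral_angular_eq_zero e₁ e₂ n hf v
  have hlap : ∀ θ, (v.1 : ℂ) * Δ f (cylPoint e₁ e₂ n θ v) =
      (v.1 : ℂ) * (fderiv ℝ (fderiv ℝ f) (cylPoint e₁ e₂ n θ v) (radial e₁ e₂ θ)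
        (radial e₁ e₂ θ) + fderiv ℝ (fderiv ℝ f) (cylPoint e₁ e₂ n θ v) n n) +
      fderiv ℝ f (cylPoint e₁ e₂ n θ v) (radial e₁ e₂ θ) +
      ((v.1 : ℂ) * fderiv ℝ (fderiv ℝ f) (cylPoint e₁ e₂ n θ v) (angular e₁ e₂ θ)
        (angular e₁ e₂ θ) - fderiv ℝ f (cylPoint e₁ e₂ n θ v) (radial e₁ e₂ θ)) := by
    intro θ
    have hcs : (Real.cos θ : ℂ) ^ 2 + (Real.sin θ : ℂ) ^ 2 = 1 := by
      exact_mod_cast Real.cos_sq_add_sin_sq θ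
    push_cast at hcs
    rw [laplacian_eq_of_orthonormal he]
    generalize fderiv ℝ (fderiv ℝ f) (cylPoint e₁ e₂ n θ v) = B
    simp only [radial, angular, map_add, map_smul, add_apply, smul_apply, Complex.real_smul]
    push_cast
    linear_combination (-(v.1 : ℂ) * (B e₁ e₁ + B e₂ e₂)) * hcs
  have hi : ∀ {g : ℝ → ℂ}, Continuous g → IntervalIntegrable g volume 0 (2 * Real.pi) :=
    fun hg => hg.intervalIntegrable _ _
  have key : (v.1 : ℂ) * ∫ θ in (0 : ℝ)..(2 * Real.pi), Δ f (cylPoint e₁ e₂ n θ v) =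
      (v.1 : ℂ) * ((∫ θ in (0 : ℝ)..(2 * Real.pi),
        fderiv ℝ (fderiv ℝ f) (cylPoint e₁ e₂ n θ v) (radial e₁ e₂ θ) (radial e₁ e₂ θ)) +
        ∫ θ in (0 : ℝ)..(2 * Real.pi), fderiv ℝ (fderiv ℝ f) (cylPoint e₁ e₂ n θ v) n n) +
      ∫ θ in (0 : ℝ)..(2 * Real.pi),
        fderiv ℝ f (cylPoint e₁ e₂ n θ v) (radial e₁ e₂ θ) := by
    rw [← intervalIntegral.integral_const_mul]
    simp only [hlap]
    rw [intervalIntegral.integral_add (hi (by fun_prop)) (hi (by fun_prop)), h0, add_zero,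
      intervalIntegral.integral_add (hi (by fun_prop)) (hi (by fun_prop)),
      intervalIntegral.integral_const_mul,
      intervalIntegral.integral_add (hi (by fun_prop)) (hi (by fun_prop))]
  simp only [Complex.real_smul]
  linear_combination (((1 / (2 * Real.pi) : ℝ) : ℂ)) * key

end CircleMeans

/-! ### Green's formula in oblate spheroidal coordinates -/

section Spheroidal

/-- The half-plane point `(ρ, ζ)` with oblate spheroidal parameters
`p = a sinh s`, `q = a sin τ`. -/
noncomputable def sph (a : ℝ) (p : ℝ × ℝ) : ℝ × ℝ :=
  (a * Real.cosh p.1 * Real.cos p.2, a * Real.sinh p.1 * Real.sin p.2)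

/-- The derivative of `sph` in `s`. -/
noncomputable def sphS (a : ℝ) (p : ℝ × ℝ) : ℝ × ℝ :=
  (a * Real.sinh p.1 * Real.cos p.2, a * Real.cosh p.1 * Real.sin p.2)

/-- The derivative of `sph` in `τ`. -/
noncomputable def sphT (a : ℝ) (p : ℝ × ℝ) : ℝ × ℝ :=
  (-(a * Real.cosh p.1 * Real.sin p.2), a * Real.sinh p.1 * Real.cos p.2)

/-- The normalized complex distance `γ / a = sinh s + i sin τ`. -/
noncomputable def gamS (p : ℝ × ℝ) : ℂ := (Real.sinh p.1 : ℂ) + Complex.I * (Real.sin p.2 : ℂ)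

/-- The flux density through the spheroid `s = const` against a function `G` of `(ρ, ζ)`. -/
noncomputable def flux (a : ℝ) (G : ℝ × ℝ → ℂ) (p : ℝ × ℝ) : ℂ :=
  (Real.cosh p.1 * Real.cos p.2 : ℝ) / gamS p * fderiv ℝ G (sph a p) (sphS a p) +
    (Real.cosh p.1 ^ 2 * Real.cos p.2 : ℝ) / gamS p ^ 2 * G (sph a p)

/-- The flux density in the direction of the angle `τ`. -/
noncomputable def fluxT (a : ℝ) (G : ℝ × ℝ → ℂ) (p : ℝ × ℝ) : ℂ :=
  (Real.cosh p.1 * Real.cos p.2 : ℝ) / gamS p * fderiv ℝ G (sph a p) (sphT a p) +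
    Complex.I * (Real.cosh p.1 * Real.cos p.2 ^ 2 : ℝ) / gamS p ^ 2 * G (sph a p)

theorem gamS_ne_zero {p : ℝ × ℝ} (hp : 0 < p.1) : gamS p ≠ 0 := by
  intro h
  have : (gamS p).re = Real.sinh p.1 := by simp [gamS, -Complex.ofReal_sinh]
  rw [h, Complex.zero_re] at this
  exact (Real.sinh_pos_iff.2 hp).ne this

theorem contDiff_sph (a : ℝ) {m : ℕ∞ω} : ContDiff ℝ m (sph a) := by
  unfold sph
  have := Real.contDiff_cosh (n := m)
  have := Real.contDiff_sinh (n := m)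
  fun_prop

theorem continuous_sph (a : ℝ) : Continuous (sph a) := by unfold sph; fun_prop
theorem continuous_sphS (a : ℝ) : Continuous (sphS a) := by unfold sphS; fun_prop
theorem continuous_sphT (a : ℝ) : Continuous (sphT a) := by unfold sphT; fun_prop
theorem continuous_gamS : Continuous gamS := by unfold gamS; fun_prop

theorem hasDerivAt_sph_fst (a s τ : ℝ) :
    HasDerivAt (fun s => sph a (s, τ)) (sphS a (s, τ)) s := by
  have h1 := ((Real.hasDerivAt_cosh s).const_mul a).mul_const (Real.cos τ)
  have h2 := ((Real.hasDerivAt_sinh s).const_mul a).mul_const (Real.sin τ)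
  exact h1.prodMk h2

theorem hasDerivAt_sph_snd (a s τ : ℝ) :
    HasDerivAt (fun τ => sph a (s, τ)) (sphT a (s, τ)) τ := by
  have h1 := (Real.hasDerivAt_cos τ).const_mul (a * Real.cosh s)
  have h2 := (Real.hasDerivAt_sin τ).const_mul (a * Real.sinh s)
  exact (h1.prodMk h2).congr_deriv (by simp [sphT])

theorem hasDerivAt_sphS (a s τ : ℝ) :
    HasDerivAt (fun s => sphS a (s, τ)) (sph a (s, τ)) s := by
  have h1 := ((Real.hasDerivAt_cosh s).const_mul a).mul_const (Real.sin τ)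
  have h2 := ((Real.hasDerivAt_sinh s).const_mul a).mul_const (Real.cos τ)
  exact h2.prodMk h1

theorem hasDerivAt_sphT (a s τ : ℝ) :
    HasDerivAt (fun τ => sphT a (s, τ)) (-sph a (s, τ)) τ := by
  have h1 := (Real.hasDerivAt_cos τ).const_mul (a * Real.sinh s)
  have h2 := ((Real.hasDerivAt_sin τ).const_mul (a * Real.cosh s)).neg
  exact (h2.prodMk h1).congr_deriv (by simp [sph])

theorem hasDerivAt_gamS_fst (s τ : ℝ) :
    HasDerivAt (fun s => gamS (s, τ)) (Real.cosh s : ℂ) s :=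
  (Real.hasDerivAt_sinh s).ofReal_comp.add_const (Complex.I * (Real.sin τ : ℂ))

theorem hasDerivAt_gamS_snd (s τ : ℝ) :
    HasDerivAt (fun τ => gamS (s, τ)) (Complex.I * (Real.cos τ : ℂ)) τ :=
  ((Real.hasDerivAt_sin τ).ofReal_comp.const_mul Complex.I).const_add (Real.sinh s : ℂ)

/-- The divergence of the flux. -/
noncomputable def fluxDiv (a : ℝ) (G : ℝ × ℝ → ℂ) (p : ℝ × ℝ) : ℂ :=
  (a * (Real.sinh p.1 ^ 2 + Real.sin p.2 ^ 2) : ℝ) / gamS p *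
    (((sph a p).1 : ℂ) * (fderiv ℝ (fun v => fderiv ℝ G v (1, 0)) (sph a p) (1, 0) +
      fderiv ℝ (fun v => fderiv ℝ G v (0, 1)) (sph a p) (0, 1)) +
      fderiv ℝ G (sph a p) (1, 0))

/-- The `s`-derivative of `flux`. -/
noncomputable def fluxDs (a : ℝ) (G : ℝ × ℝ → ℂ) (p : ℝ × ℝ) : ℂ :=
  (Real.sinh p.1 * Real.cos p.2 : ℝ) / gamS p * fderiv ℝ G (sph a p) (sphS a p) +
  (Real.cosh p.1 * Real.cos p.2 : ℝ) / gamS p *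
    (fderiv ℝ (fderiv ℝ G) (sph a p) (sphS a p) (sphS a p) + fderiv ℝ G (sph a p) (sph a p)) +
  ((2 * Real.cosh p.1 * Real.sinh p.1 * Real.cos p.2 : ℝ) / gamS p ^ 2 -
    2 * (Real.cosh p.1 ^ 3 * Real.cos p.2 : ℝ) / gamS p ^ 3) * G (sph a p)

/-- The `τ`-derivative of `fluxT`. -/
noncomputable def fluxDt (a : ℝ) (G : ℝ × ℝ → ℂ) (p : ℝ × ℝ) : ℂ :=
  -((Real.cosh p.1 * Real.sin p.2 : ℝ) / gamS p) * fderiv ℝ G (sph a p) (sphT a p) +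
  (Real.cosh p.1 * Real.cos p.2 : ℝ) / gamS p *
    (fderiv ℝ (fderiv ℝ G) (sph a p) (sphT a p) (sphT a p) - fderiv ℝ G (sph a p) (sph a p)) +
  (-Complex.I * (2 * Real.cosh p.1 * Real.cos p.2 * Real.sin p.2 : ℝ) / gamS p ^ 2 +
    2 * (Real.cosh p.1 * Real.cos p.2 ^ 3 : ℝ) / gamS p ^ 3) * G (sph a p)

theorem hasDerivAt_flux (a : ℝ) {G : ℝ × ℝ → ℂ} (hG : ContDiff ℝ 2 G) {s : ℝ} (hs : 0 < s)
    (τ : ℝ) : HasDerivAt (fun s => flux a G (s, τ)) (fluxDs a G (s, τ)) s := by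
  have hw : gamS (s, τ) ≠ 0 := gamS_ne_zero hs
  have hG' : ContDiff ℝ 1 (fderiv ℝ G) := hG.fderiv_right one_add_one_eq_two.le
  have h1 : HasDerivAt (fun s => G (sph a (s, τ))) _ s :=
    (hG.differentiable two_ne_zero (sph a (s, τ))).hasFDerivAt.comp_hasDerivAt s
      (hasDerivAt_sph_fst a s τ)
  have h0 : HasDerivAt (fun s => fderiv ℝ G (sph a (s, τ)))
      (fderiv ℝ (fderiv ℝ G) (sph a (s, τ)) (sphS a (s, τ))) s :=
    (hG'.differentiable one_ne_zero (sph a (s, τ))).hasFDerivAt.comp_hasDerivAt s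
      (hasDerivAt_sph_fst a s τ)
  have h2 := h0.clm_apply (hasDerivAt_sphS a s τ)
  have h3 : HasDerivAt (fun s => ((Real.cosh s * Real.cos τ : ℝ) : ℂ) / gamS (s, τ)) _ s :=
    ((Real.hasDerivAt_cosh s).mul_const (Real.cos τ)).ofReal_comp.div
      (hasDerivAt_gamS_fst s τ) hw
  have h4 : HasDerivAt (fun s => ((Real.cosh s ^ 2 * Real.cos τ : ℝ) : ℂ) / gamS (s, τ) ^ 2) _ s :=
    (((Real.hasDerivAt_cosh s).pow 2).mul_const (Real.cos τ)).ofReal_comp.div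
      ((hasDerivAt_gamS_fst s τ).pow 2) (pow_ne_zero 2 hw)
  simp only [flux]
  refine ((h3.mul h2).add (h4.mul h1)).congr_deriv ?_
  simp only [fluxDs, Pi.pow_apply]
  generalize fderiv ℝ (fderiv ℝ G) (sph a (s, τ)) (sphS a (s, τ)) (sphS a (s, τ)) = B
  generalize fderiv ℝ G (sph a (s, τ)) (sph a (s, τ)) = D
  generalize fderiv ℝ G (sph a (s, τ)) (sphS a (s, τ)) = E
  generalize G (sph a (s, τ)) = F
  generalize gamS (s, τ) = w at hw
  push_cast
  field_simp
  ring

theorem hasDerivAt_fluxT (a : ℝ) {G : ℝ × ℝ → ℂ} (hG : ContDiff ℝ 2 G) {s : ℝ} (hs : 0 < s)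
    (τ : ℝ) : HasDerivAt (fun τ => fluxT a G (s, τ)) (fluxDt a G (s, τ)) τ := by
  have hw : gamS (s, τ) ≠ 0 := gamS_ne_zero hs
  have hG' : ContDiff ℝ 1 (fderiv ℝ G) := hG.fderiv_right one_add_one_eq_two.le
  have h1 : HasDerivAt (fun τ => G (sph a (s, τ))) _ τ :=
    (hG.differentiable two_ne_zero (sph a (s, τ))).hasFDerivAt.comp_hasDerivAt τ
      (hasDerivAt_sph_snd a s τ)
  have h0 : HasDerivAt (fun τ => fderiv ℝ G (sph a (s, τ)))
      (fderiv ℝ (fderiv ℝ G) (sph a (s, τ)) (sphT a (s, τ))) τ :=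
    (hG'.differentiable one_ne_zero (sph a (s, τ))).hasFDerivAt.comp_hasDerivAt τ
      (hasDerivAt_sph_snd a s τ)
  have h2 := h0.clm_apply (hasDerivAt_sphT a s τ)
  have h3 : HasDerivAt (fun τ => ((Real.cosh s * Real.cos τ : ℝ) : ℂ) / gamS (s, τ)) _ τ :=
    ((Real.hasDerivAt_cos τ).const_mul (Real.cosh s)).ofReal_comp.div
      (hasDerivAt_gamS_snd s τ) hw
  have h4 : HasDerivAt (fun τ => Complex.I * ((Real.cosh s * Real.cos τ ^ 2 : ℝ) : ℂ) /
      gamS (s, τ) ^ 2) _ τ :=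
    ((((Real.hasDerivAt_cos τ).pow 2).const_mul (Real.cosh s)).ofReal_comp.const_mul
      Complex.I).div ((hasDerivAt_gamS_snd s τ).pow 2) (pow_ne_zero 2 hw)
  simp only [fluxT]
  refine ((h3.mul h2).add (h4.mul h1)).congr_deriv ?_
  simp only [fluxDt, Pi.pow_apply, map_neg]
  generalize fderiv ℝ (fderiv ℝ G) (sph a (s, τ)) (sphT a (s, τ)) (sphT a (s, τ)) = B
  generalize fderiv ℝ G (sph a (s, τ)) (sph a (s, τ)) = D
  generalize fderiv ℝ G (sph a (s, τ)) (sphT a (s, τ)) = E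
  generalize G (sph a (s, τ)) = F
  generalize gamS (s, τ) = w at hw
  push_cast
  field_simp
  ring_nf
  simp only [Complex.I_sq]
  ring

/-- With u = 1/w, the two fluxes are the s- and τ-components of (ρ/a)(u ∇G - G ∇u). By conformality
the operator div(ρ ∇G) only picks up the Jacobian, and the terms in G cancel since u is an
axisymmetric harmonic function. -/
theorem fluxDs_add_fluxDt (a : ℝ) {G : ℝ × ℝ → ℂ} (hG : ContDiff ℝ 2 G) {p : ℝ × ℝ}
    (hp : 0 < p.1) : fluxDs a G p + fluxDt a G p = fluxDiv a G p := by
  have hw : gamS p ≠ 0 := gamS_ne_zero hp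
  have hG' : ContDiff ℝ 1 (fderiv ℝ G) := hG.fderiv_right one_add_one_eq_two.le
  have hd := hG'.differentiable one_ne_zero (sph a p)
  have e (b c : ℝ × ℝ) : fderiv ℝ (fun v => fderiv ℝ G v b) (sph a p) c =
      fderiv ℝ (fderiv ℝ G) (sph a p) c b := by
    rw [fderiv_clm_apply hd (differentiableAt_const b)]
    simp
  have hS : sphS a p = (a * Real.sinh p.1 * Real.cos p.2) • ((1 : ℝ), (0 : ℝ)) +
      (a * Real.cosh p.1 * Real.sin p.2) • ((0 : ℝ), (1 : ℝ)) := by simp [sphS]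
  have hT : sphT a p = (-(a * Real.cosh p.1 * Real.sin p.2)) • ((1 : ℝ), (0 : ℝ)) +
      (a * Real.sinh p.1 * Real.cos p.2) • ((0 : ℝ), (1 : ℝ)) := by simp [sphT]
  have h1 : (Real.cosh p.1 : ℂ) ^ 2 = 1 + (Real.sinh p.1 : ℂ) ^ 2 := by
    exact_mod_cast (by rw [Real.cosh_sq]; ring : Real.cosh p.1 ^ 2 = 1 + Real.sinh p.1 ^ 2)
  have h2 : (Real.cos p.2 : ℂ) ^ 2 = 1 - (Real.sin p.2 : ℂ) ^ 2 := by
    exact_mod_cast Real.cos_sq' p.2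
  simp only [fluxDs, fluxDt, fluxDiv, e, hS, hT]
  generalize fderiv ℝ (fderiv ℝ G) (sph a p) = B
  generalize fderiv ℝ G (sph a p) = D
  simp only [map_add, map_smul, add_apply, smul_apply, Complex.real_smul]
  have h3 : (sph a p).1 = a * Real.cosh p.1 * Real.cos p.2 := rfl
  have h4 : gamS p = (Real.sinh p.1 : ℂ) + Complex.I * (Real.sin p.2 : ℂ) := rfl
  rw [h3]
  simp only [Complex.ofReal_mul, Complex.ofReal_add, Complex.ofReal_pow, Complex.ofReal_neg,
    Complex.ofReal_ofNat]
  generalize G (sph a p) = F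
  generalize gamS p = w at *
  generalize (Real.cosh p.1 : ℂ) = C at *
  generalize (Real.sinh p.1 : ℂ) = S at *
  generalize (Real.cos p.2 : ℂ) = c at *
  generalize (Real.sin p.2 : ℂ) = t at *
  generalize B (1, 0) (1, 0) = B11
  generalize B (0, 1) (1, 0) = B21
  generalize B (1, 0) (0, 1) = B12
  generalize B (0, 1) (0, 1) = B22
  generalize D (1, 0) = D1
  generalize D (0, 1) = D2
  field_simp
  -- The first factor turns sinh² cos² + cosh² sin² into the Jacobian sinh² + sin²; the second,
  -- which kills the G term, is (sinh s - i sin τ) w = sinh² + sin² = cosh² - cos².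
  linear_combination (w ^ 2 * a ^ 2 * C * c * (B11 + B22) + w ^ 2 * a * D1) *
    (S ^ 2 * h2 + t ^ 2 * h1) + 2 * C * c * F *
    ((S - Complex.I * t) * h4 - t ^ 2 * Complex.I_sq - h1 + h2)

theorem continuousOn_gamS_inv {s₀ S : ℝ} (hs : 0 < s₀) (k : ℕ) :
    ContinuousOn (fun p => (gamS p ^ k)⁻¹) (Icc s₀ S ×ˢ univ) :=
  (continuous_gamS.pow k).continuousOn.inv₀ fun _ hp =>
    pow_ne_zero k (gamS_ne_zero (hs.trans_le hp.1.1))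

theorem continuousOn_fluxDs (a : ℝ) {G : ℝ × ℝ → ℂ} (hG : ContDiff ℝ 2 G) {s₀ S : ℝ}
    (hs : 0 < s₀) : ContinuousOn (fluxDs a G) (Icc s₀ S ×ˢ univ) := by
  have hG' : ContDiff ℝ 1 (fderiv ℝ G) := hG.fderiv_right one_add_one_eq_two.le
  have h1 := continuousOn_gamS_inv (S := S) hs 1
  have h2 := continuousOn_gamS_inv (S := S) hs 2
  have h3 := continuousOn_gamS_inv (S := S) hs 3
  have hc0 := hG.continuous
  have hc1 := hG'.continuous
  have hc2 := hG'.continuous_fderiv one_ne_zero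
  have i0 := continuous_sph a
  have i1 := continuous_sphS a
  simp only [pow_one] at h1
  unfold fluxDs
  simp only [div_eq_mul_inv]
  fun_prop

theorem continuousOn_fluxDt (a : ℝ) {G : ℝ × ℝ → ℂ} (hG : ContDiff ℝ 2 G) {s₀ S : ℝ}
    (hs : 0 < s₀) : ContinuousOn (fluxDt a G) (Icc s₀ S ×ˢ univ) := by
  have hG' : ContDiff ℝ 1 (fderiv ℝ G) := hG.fderiv_right one_add_one_eq_two.le
  have h1 := continuousOn_gamS_inv (S := S) hs 1
  have h2 := continuousOn_gamS_inv (S := S) hs 2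
  have h3 := continuousOn_gamS_inv (S := S) hs 3
  have hc0 := hG.continuous
  have hc1 := hG'.continuous
  have hc2 := hG'.continuous_fderiv one_ne_zero
  have i0 := continuous_sph a
  have i1 := continuous_sphT a
  simp only [pow_one] at h1
  unfold fluxDt
  simp only [div_eq_mul_inv]
  fun_prop

theorem continuous_flux (a : ℝ) {G : ℝ × ℝ → ℂ} (hG : ContDiff ℝ 1 G) {s : ℝ} (hs : 0 < s) :
    Continuous fun τ => flux a G (s, τ) := by
  have hc0 := hG.continuous
  have hc1 := hG.continuous_fderiv one_ne_zero
  have i0 := continuous_sph a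
  have i1 := continuous_sphS a
  have i2 := continuous_gamS
  have i3 : ∀ τ, gamS (s, τ) ≠ 0 := fun τ => gamS_ne_zero hs
  unfold flux
  fun_prop (disch := intro; simp [i3])

/-- The flux through the spheroid `s = s₀` of a function vanishing near the spheroid `s = S` is
minus the integral of the divergence over the shell between them. -/
theorem integral_fluxDiv (a : ℝ) {G : ℝ × ℝ → ℂ} (hG : ContDiff ℝ 2 G) {s₀ S : ℝ}
    (hs : 0 < s₀) (hS : s₀ ≤ S) (hv : ∀ τ, flux a G (S, τ) = 0) :
    ∫ p in Icc s₀ S ×ˢ Icc (-(Real.pi / 2)) (Real.pi / 2), fluxDiv a G p =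
      -∫ τ in (-(Real.pi / 2))..(Real.pi / 2), flux a G (s₀, τ) := by
  set l := -(Real.pi / 2) with hl
  set r := Real.pi / 2 with hr
  have hlr : l ≤ r := by have := Real.pi_pos; linarith
  have hK : IsCompact (Icc s₀ S ×ˢ Icc l r) := isCompact_Icc.prod isCompact_Icc
  have hsub : Icc s₀ S ×ˢ Icc l r ⊆ Icc s₀ S ×ˢ (univ : Set ℝ) :=
    prod_mono_right (subset_univ _)
  have c1 := (continuousOn_fluxDs a hG (S := S) hs)
  have c2 := (continuousOn_fluxDt a hG (S := S) hs)
  have i1 : IntegrableOn (fluxDs a G) (Icc s₀ S ×ˢ Icc l r) :=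
    (c1.mono hsub).integrableOn_compact hK
  have i2 : IntegrableOn (fluxDt a G) (Icc s₀ S ×ˢ Icc l r) :=
    (c2.mono hsub).integrableOn_compact hK
  have hm : MeasurableSet (Icc s₀ S ×ˢ Icc l r) := measurableSet_Icc.prod measurableSet_Icc
  have e1 : ∫ p in Icc s₀ S ×ˢ Icc l r, fluxDiv a G p =
      (∫ p in Icc s₀ S ×ˢ Icc l r, fluxDs a G p) +
        ∫ p in Icc s₀ S ×ˢ Icc l r, fluxDt a G p := by
    rw [← integral_add i1 i2]
    exact setIntegral_congr_fun hm fun p hp =>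
      (fluxDs_add_fluxDt a hG (hs.trans_le hp.1.1)).symm
  have e2 : ∫ p in Icc s₀ S ×ˢ Icc l r, fluxDt a G p = 0 := by
    rw [Measure.volume_eq_prod, setIntegral_prod _ i2]
    refine (setIntegral_congr_fun (g := fun _ => (0 : ℂ)) measurableSet_Icc
      fun s hs' => ?_).trans (by simp)
    have hs0 : 0 < s := hs.trans_le hs'.1
    have hcont : Continuous fun τ => fluxDt a G (s, τ) :=
      c2.comp_continuous (Continuous.prodMk_right s) fun τ => ⟨hs', mem_univ _⟩
    dsimp only
    rw [integral_Icc_eq_integral_Ioc, ← intervalIntegral.integral_of_le hlr,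
      intervalIntegral.integral_eq_sub_of_hasDerivAt (fun τ _ => hasDerivAt_fluxT a hG hs0 τ)
        (hcont.intervalIntegrable _ _)]
    -- `fluxT` carries the factor cos τ, zero at τ = ±π/2: no flux crosses the axis ρ = 0.
    simp [fluxT, hl, hr]
  have e3 : ∫ p in Icc s₀ S ×ˢ Icc l r, fluxDs a G p = -∫ τ in l..r, flux a G (s₀, τ) := by
    rw [Measure.volume_eq_prod, ← setIntegral_prod_swap,
      setIntegral_prod (fun z => fluxDs a G z.swap) i1.swap,
      intervalIntegral.integral_of_le hlr, ← integral_Icc_eq_integral_Ioc, ← integral_neg]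
    refine setIntegral_congr_fun measurableSet_Icc fun τ _ => ?_
    have hcont : ContinuousOn (fun s => fluxDs a G (s, τ)) (Icc s₀ S) :=
      c1.comp (Continuous.prodMk_left τ).continuousOn fun s hs' => ⟨hs', mem_univ _⟩
    simp only [Prod.swap_prod_mk]
    rw [integral_Icc_eq_integral_Ioc, ← intervalIntegral.integral_of_le hS,
      intervalIntegral.integral_eq_sub_of_hasDerivAt
        (fun s hs' => hasDerivAt_flux a hG (hs.trans_le (uIcc_of_le hS ▸ hs').1) τ)
        (hcont.intervalIntegrable_of_Icc hS), hv, zero_sub]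
  rw [e1, e2, e3, add_zero]

end Spheroidal

/-! ### Uniform flux estimates and the limit onto the disk -/

section FluxLimit

theorem norm_gamS_sq (p : ℝ × ℝ) : ‖gamS p‖ ^ 2 = Real.sinh p.1 ^ 2 + Real.sin p.2 ^ 2 := by
  rw [gamS, mul_comm Complex.I, Complex.sq_norm, Complex.normSq_add_mul_I]

theorem abs_sinh_le_norm_gamS (p : ℝ × ℝ) : |Real.sinh p.1| ≤ ‖gamS p‖ :=
  abs_le_of_sq_le_sq (by rw [norm_gamS_sq]; nlinarith [sq_nonneg (Real.sin p.2)]) (norm_nonneg _)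

theorem abs_sin_le_norm_gamS (p : ℝ × ℝ) : |Real.sin p.2| ≤ ‖gamS p‖ :=
  abs_le_of_sq_le_sq (by rw [norm_gamS_sq]; nlinarith [sq_nonneg (Real.sinh p.1)]) (norm_nonneg _)

theorem abs_sinh_le_cosh (x : ℝ) : |Real.sinh x| ≤ Real.cosh x :=
  abs_le_of_sq_le_sq (by rw [Real.cosh_sq]; linarith) (Real.cosh_pos x).le

theorem norm_sph_le {a : ℝ} (ha : 0 ≤ a) (p : ℝ × ℝ) : ‖sph a p‖ ≤ a * Real.cosh p.1 := by
  have hc := Real.cosh_pos p.1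
  refine norm_prod_le_iff.2 ⟨?_, ?_⟩
  · simp only [sph, Real.norm_eq_abs, abs_mul, abs_of_nonneg ha, abs_of_pos (Real.cosh_pos _)]
    exact mul_le_of_le_one_right (by positivity) (Real.abs_cos_le_one _)
  · simp only [sph, Real.norm_eq_abs, abs_mul, abs_of_nonneg ha]
    calc a * |Real.sinh p.1| * |Real.sin p.2| ≤ a * |Real.sinh p.1| :=
          mul_le_of_le_one_right (by positivity) (Real.abs_sin_le_one _)
      _ ≤ _ := by gcongr; exact abs_sinh_le_cosh _

/-- By conformality ∂_s(ρ, ζ) has Euclidean length exactly a |w|; the factor cosh s is slack. -/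
theorem norm_sphS_le {a : ℝ} (ha : 0 ≤ a) (p : ℝ × ℝ) :
    ‖sphS a p‖ ≤ a * Real.cosh p.1 * ‖gamS p‖ := by
  have hc := Real.one_le_cosh p.1
  have h1 := abs_sinh_le_norm_gamS p
  have h2 := abs_sin_le_norm_gamS p
  refine norm_prod_le_iff.2 ⟨?_, ?_⟩
  · simp only [sphS, Real.norm_eq_abs, abs_mul, abs_of_nonneg ha]
    calc a * |Real.sinh p.1| * |Real.cos p.2| ≤ a * |Real.sinh p.1| :=
          mul_le_of_le_one_right (by positivity) (Real.abs_cos_le_one _)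
      _ ≤ a * ‖gamS p‖ := by gcongr
      _ ≤ a * Real.cosh p.1 * ‖gamS p‖ := by
          gcongr
          exact le_mul_of_one_le_right ha hc
  · simp only [sphS, Real.norm_eq_abs, abs_mul, abs_of_nonneg ha, abs_of_pos (Real.cosh_pos _)]
    gcongr

/-- Near the rim γ behaves like the square root of the displacement from it. Nonnegativity of cos τ
is needed for cos τ ≥ cos² τ, which gives 1 - cosh s cos τ ≤ sin² τ. -/
theorem norm_sph_sub_le {a : ℝ} (ha : 0 ≤ a) {p : ℝ × ℝ} (hp : 0 ≤ Real.cos p.2) :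
    ‖sph a p - (a, 0)‖ ≤ a * ‖gamS p‖ ^ 2 := by
  have hC := Real.one_le_cosh p.1
  have hc := Real.cos_le_one p.2
  have h1 := Real.cosh_sq p.1
  have h2 := Real.sin_sq_add_cos_sq p.2
  rw [norm_gamS_sq]
  refine norm_prod_le_iff.2 ⟨?_, ?_⟩
  · simp only [sph, Prod.fst_sub, Real.norm_eq_abs]
    rw [show a * Real.cosh p.1 * Real.cos p.2 - a = a * (Real.cosh p.1 * Real.cos p.2 - 1) by ring,
      abs_mul, abs_of_nonneg ha]
    gcongr
    rw [abs_le]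
    constructor <;> nlinarith
  · simp only [sph, Prod.snd_sub, sub_zero, Real.norm_eq_abs]
    rw [mul_assoc, abs_mul, abs_of_nonneg ha]
    gcongr
    rw [abs_le]
    constructor <;> nlinarith [sq_nonneg (Real.sinh p.1 + Real.sin p.2),
      sq_nonneg (Real.sinh p.1 - Real.sin p.2), sq_nonneg (Real.sinh p.1), sq_nonneg (Real.sin p.2)]

/-- The flux density with the value of `G` on the rim subtracted. -/
noncomputable def fluxReg (a : ℝ) (G : ℝ × ℝ → ℂ) (p : ℝ × ℝ) : ℂ :=
  (Real.cosh p.1 * Real.cos p.2 : ℝ) / gamS p * fderiv ℝ G (sph a p) (sphS a p) +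
    (Real.cosh p.1 ^ 2 * Real.cos p.2 : ℝ) / gamS p ^ 2 * (G (sph a p) - G (a, 0))

theorem flux_eq (a : ℝ) (G : ℝ × ℝ → ℂ) (p : ℝ × ℝ) :
    flux a G p = fluxReg a G p +
      (Real.cosh p.1 ^ 2 * Real.cos p.2 : ℝ) / gamS p ^ 2 * G (a, 0) := by
  rw [flux, fluxReg]
  ring

/-- The kernels are of size 1/|w| and 1/|w|², and the factors they multiply are O(|w|) and O(|w|²),
so the bound does not degenerate at s = 0. -/
theorem norm_fluxReg_le {a : ℝ} (ha : 0 ≤ a) {G : ℝ × ℝ → ℂ} (hG : ContDiff ℝ 1 G) {M R : ℝ}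
    (hM : ∀ v, ‖v‖ ≤ R → ‖fderiv ℝ G v‖ ≤ M) {p : ℝ × ℝ} (hp : 0 ≤ Real.cos p.2)
    (hR : a * Real.cosh p.1 ≤ R) : ‖fluxReg a G p‖ ≤ 2 * a * Real.cosh p.1 ^ 2 * M := by
  have hC := Real.one_le_cosh p.1
  have hc := Real.cos_le_one p.2
  have haR : ‖((a, 0) : ℝ × ℝ)‖ ≤ R := by
    rw [norm_prod_le_iff]
    have : a ≤ a * Real.cosh p.1 := le_mul_of_one_le_right ha hC
    simp only [Real.norm_eq_abs, abs_of_nonneg ha, norm_zero]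
    constructor <;> linarith
  have hsR : ‖sph a p‖ ≤ R := (norm_sph_le ha p).trans hR
  have hM0 : 0 ≤ M := (norm_nonneg _).trans (hM _ hsR)
  -- At the rim itself division by zero makes `fluxReg` vanish, so the bound also covers s = 0, τ =
  -- 0.
  by_cases hw : gamS p = 0
  · have : fluxReg a G p = 0 := by simp [fluxReg, hw]
    rw [this, norm_zero]
    positivity
  have hw0 : 0 < ‖gamS p‖ := norm_pos_iff.2 hw
  have h1 : ‖fderiv ℝ G (sph a p) (sphS a p)‖ ≤ M * (a * Real.cosh p.1 * ‖gamS p‖) :=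
    ((fderiv ℝ G _).le_opNorm _).trans
      (mul_le_mul (hM _ hsR) (norm_sphS_le ha p) (norm_nonneg _) hM0)
  have h2 : ‖G (sph a p) - G (a, 0)‖ ≤ M * (a * ‖gamS p‖ ^ 2) := by
    have := (convex_closedBall (0 : ℝ × ℝ) R).norm_image_sub_le_of_norm_fderiv_le (𝕜 := ℝ)
      (f := G) (fun x _ => hG.differentiable one_ne_zero x)
      (fun x hx => hM x (mem_closedBall_zero_iff.1 hx)) (mem_closedBall_zero_iff.2 haR)
      (mem_closedBall_zero_iff.2 hsR)
    exact this.trans (mul_le_mul_of_nonneg_left (norm_sph_sub_le ha hp) hM0)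
  have e1 : ‖((Real.cosh p.1 * Real.cos p.2 : ℝ) : ℂ) / gamS p‖ ≤ Real.cosh p.1 / ‖gamS p‖ := by
    rw [norm_div, Complex.norm_real, Real.norm_of_nonneg (by positivity)]
    gcongr
    exact mul_le_of_le_one_right (by positivity) hc
  have e2 : ‖((Real.cosh p.1 ^ 2 * Real.cos p.2 : ℝ) : ℂ) / gamS p ^ 2‖ ≤
      Real.cosh p.1 ^ 2 / ‖gamS p‖ ^ 2 := by
    rw [norm_div, Complex.norm_real, Real.norm_of_nonneg (by positivity), norm_pow]
    gcongr
    exact mul_le_of_le_one_right (by positivity) hc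
  calc ‖fluxReg a G p‖ ≤ Real.cosh p.1 / ‖gamS p‖ * (M * (a * Real.cosh p.1 * ‖gamS p‖)) +
        Real.cosh p.1 ^ 2 / ‖gamS p‖ ^ 2 * (M * (a * ‖gamS p‖ ^ 2)) := by
        refine (norm_add_le _ _).trans (add_le_add ?_ ?_) <;> rw [norm_mul]
        · exact mul_le_mul e1 h1 (norm_nonneg _) (by positivity)
        · exact mul_le_mul e2 h2 (norm_nonneg _) (by positivity)
    _ = 2 * a * Real.cosh p.1 ^ 2 * M := by field_simp; ring

/-- Half the total flux through the spheroid with parameter `s`. -/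
noncomputable def surf (a : ℝ) (G : ℝ × ℝ → ℂ) (s : ℝ) : ℂ :=
  (1 / 2 : ℂ) * ∫ τ in (-(Real.pi / 2))..(Real.pi / 2), flux a G (s, τ)

theorem cos_nonneg_of_mem_uIoc {τ : ℝ} (h : τ ∈ uIoc (-(Real.pi / 2)) (Real.pi / 2)) :
    0 ≤ Real.cos τ := by
  rw [uIoc_of_le (by linarith [Real.pi_pos])] at h
  exact Real.cos_nonneg_of_mem_Icc ⟨h.1.le, h.2⟩

theorem continuous_kernel {s : ℝ} (hs : 0 < s) : Continuous fun τ =>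
    ((Real.cosh s ^ 2 * Real.cos τ : ℝ) : ℂ) / gamS (s, τ) ^ 2 := by
  have i2 := continuous_gamS
  have i3 : ∀ τ, gamS (s, τ) ≠ 0 := fun τ => gamS_ne_zero hs
  fun_prop (disch := intro; simp [i3])

/-- The integrand is cosh² s times the τ-derivative of i/w, and w = sinh s ± i at the endpoints,
where the product of the two values is cosh² s. The value does not depend on s; this is how the rim
value acquires coefficient 1. -/
theorem integral_kernel {s : ℝ} (hs : 0 < s) :
    ∫ τ in (-(Real.pi / 2))..(Real.pi / 2),
      ((Real.cosh s ^ 2 * Real.cos τ : ℝ) : ℂ) / gamS (s, τ) ^ 2 = 2 := by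
  have i3 : ∀ τ, gamS (s, τ) ≠ 0 := fun τ => gamS_ne_zero hs
  have hd : ∀ τ, HasDerivAt (fun τ => (Real.cosh s : ℂ) ^ 2 * (Complex.I * (gamS (s, τ))⁻¹))
      (((Real.cosh s ^ 2 * Real.cos τ : ℝ) : ℂ) / gamS (s, τ) ^ 2) τ := by
    intro τ
    refine (((hasDerivAt_gamS_snd s τ).inv (i3 τ)).const_mul Complex.I |>.const_mul
      ((Real.cosh s : ℂ) ^ 2)).congr_deriv ?_
    push_cast
    linear_combination (-(Complex.cosh s ^ 2 * Complex.cos τ / gamS (s, τ) ^ 2)) * Complex.I_sq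
  rw [intervalIntegral.integral_eq_sub_of_hasDerivAt (fun τ _ => hd τ)
    ((continuous_kernel hs).intervalIntegrable _ _)]
  have h1 := i3 (Real.pi / 2)
  have h2 := i3 (-(Real.pi / 2))
  have h3 : (Real.cosh s : ℂ) ^ 2 = 1 + (Real.sinh s : ℂ) ^ 2 := by
    exact_mod_cast (by rw [Real.cosh_sq]; ring : Real.cosh s ^ 2 = 1 + Real.sinh s ^ 2)
  simp only [gamS, Real.sin_neg, Real.sin_pi_div_two] at h1 h2 ⊢
  generalize (Real.cosh s : ℂ) = C at *
  generalize (Real.sinh s : ℂ) = S at *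
  push_cast at h1 h2 ⊢
  simp only [mul_neg, mul_one, ← sub_eq_add_neg] at h1 h2 ⊢
  field_simp
  linear_combination (-2 * C ^ 2 + 2) * Complex.I_sq + 2 * h3

theorem continuous_fluxReg (a : ℝ) {G : ℝ × ℝ → ℂ} (hG : ContDiff ℝ 1 G) {s : ℝ} (hs : 0 < s) :
    Continuous fun τ => fluxReg a G (s, τ) := by
  have h := (continuous_flux a hG hs).sub
    ((continuous_kernel hs).mul_const (G (a, 0)))
  refine h.congr fun τ => ?_
  exact sub_eq_iff_eq_add.2 (flux_eq a G (s, τ))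

theorem surf_eq (a : ℝ) {G : ℝ × ℝ → ℂ} (hG : ContDiff ℝ 1 G) {s : ℝ} (hs : 0 < s) :
    surf a G s = (1 / 2 : ℂ) * (∫ τ in (-(Real.pi / 2))..(Real.pi / 2), fluxReg a G (s, τ)) +
      G (a, 0) := by
  simp only [surf, flux_eq]
  rw [intervalIntegral.integral_add ((continuous_fluxReg a hG hs).intervalIntegrable _ _)
    (((continuous_kernel hs).mul_const (G (a, 0))).intervalIntegrable _ _),
    intervalIntegral.integral_mul_const, integral_kernel hs]
  ring

theorem norm_surf_le {a : ℝ} (ha : 0 ≤ a) {G : ℝ × ℝ → ℂ} (hG : ContDiff ℝ 1 G) {M R s : ℝ}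
    (hs : 0 < s) (hM : ∀ v, ‖v‖ ≤ R → ‖G v‖ ≤ M ∧ ‖fderiv ℝ G v‖ ≤ 2 * M)
    (hR : a * Real.cosh s ≤ R) :
    ‖surf a G s‖ ≤ (2 * Real.pi * a * Real.cosh s ^ 2 + 1) * M := by
  have hp := Real.pi_pos
  have h := intervalIntegral.norm_integral_le_of_norm_le_const
    (a := -(Real.pi / 2)) (b := Real.pi / 2) (f := fun τ => fluxReg a G (s, τ))
    (C := 2 * a * Real.cosh s ^ 2 * (2 * M)) fun τ hτ =>
      norm_fluxReg_le ha hG (fun v hv => (hM v hv).2) (p := (s, τ)) (cos_nonneg_of_mem_uIoc hτ) hR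
  rw [sub_neg_eq_add, add_halves, abs_of_pos hp] at h
  have haR : ‖((a, 0) : ℝ × ℝ)‖ ≤ R := by
    have : a ≤ a * Real.cosh s := le_mul_of_one_le_right ha (Real.one_le_cosh s)
    rw [norm_prod_le_iff]
    simp only [Real.norm_eq_abs, abs_of_nonneg ha, norm_zero]
    constructor <;> linarith
  rw [surf_eq a hG hs]
  refine (norm_add_le _ _).trans ?_
  rw [norm_mul]
  have : ‖(1 / 2 : ℂ)‖ = 1 / 2 := by norm_num
  rw [this]
  have := (hM _ haR).1
  linarith

theorem continuousAt_fluxReg (a : ℝ) {G : ℝ × ℝ → ℂ} (hG : ContDiff ℝ 1 G) {p : ℝ × ℝ}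
    (hp : gamS p ≠ 0) : ContinuousAt (fluxReg a G) p := by
  have hc0 := hG.continuous
  have hc1 := hG.continuous_fderiv one_ne_zero
  have i0 := continuous_sph a
  have i1 := continuous_sphS a
  have i2 := continuous_gamS
  unfold fluxReg
  fun_prop (disch := simp [hp])

/-- The limit of the flux as the spheroid degenerates to the disk. -/
theorem tendsto_surf {a : ℝ} (ha : 0 ≤ a) {G : ℝ × ℝ → ℂ} (hG : ContDiff ℝ 1 G) :
    Tendsto (surf a G) (𝓝[>] 0)
      (𝓝 ((1 / 2 : ℂ) * (∫ τ in (-(Real.pi / 2))..(Real.pi / 2), fluxReg a G (0, τ)) +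
        G (a, 0))) := by
  obtain ⟨M, hM⟩ := (isCompact_closedBall (0 : ℝ × ℝ) (a * Real.cosh 1)
    ).exists_bound_of_continuousOn (hG.continuous_fderiv one_ne_zero).continuousOn
  have hM0 : 0 ≤ M := (norm_nonneg _).trans
    (hM 0 (Metric.mem_closedBall_self (by have := Real.cosh_pos 1; positivity)))
  have hev : ∀ᶠ s : ℝ in 𝓝[>] 0, 0 < s ∧ s < 1 :=
    (eventually_mem_nhdsWithin).and (nhdsWithin_le_nhds (Iio_mem_nhds one_pos))
  have hlim : Tendsto (fun s => ∫ τ in (-(Real.pi / 2))..(Real.pi / 2), fluxReg a G (s, τ))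
      (𝓝[>] 0) (𝓝 (∫ τ in (-(Real.pi / 2))..(Real.pi / 2), fluxReg a G (0, τ))) := by
    refine intervalIntegral.tendsto_integral_filter_of_dominated_convergence
      (fun _ => 2 * a * Real.cosh 1 ^ 2 * M) ?_ ?_ intervalIntegrable_const ?_
    · filter_upwards [hev] with s hs
      exact (continuous_fluxReg a hG hs.1).aestronglyMeasurable
    · filter_upwards [hev] with s hs
      refine Eventually.of_forall fun τ hτ => ?_
      have hcs : Real.cosh s ≤ Real.cosh 1 := by
        rw [Real.cosh_le_cosh, abs_of_pos hs.1, abs_one]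
        exact hs.2.le
      refine (norm_fluxReg_le ha hG (fun v hv => hM v (mem_closedBall_zero_iff.2 hv))
        (p := (s, τ)) (cos_nonneg_of_mem_uIoc hτ) (by gcongr)).trans ?_
      have := Real.cosh_pos s
      dsimp only
      gcongr
    · have h0 : ∀ᵐ τ : ℝ, τ ≠ 0 := Measure.ae_ne volume 0
      filter_upwards [h0] with τ h0 hτ
      -- On the disk w = i sin τ, which vanishes in the range only at the discarded point τ = 0.
      have hw : gamS (0, τ) ≠ 0 := by
        have hp := Real.pi_pos
        rw [uIoc_of_le (by linarith)] at hτ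
        have hsin : Real.sin τ ≠ 0 := by
          rcases lt_or_gt_of_ne h0 with h | h
          · exact (Real.sin_neg_of_neg_of_neg_pi_lt h (by linarith [hτ.1])).ne
          · exact (Real.sin_pos_of_pos_of_lt_pi h (by linarith [hτ.2])).ne'
        simpa [gamS, -Complex.ofReal_sin] using hsin
      have h1 : Tendsto (fun s : ℝ => (s, τ)) (𝓝[>] 0) (𝓝 (0, τ)) :=
        ((Continuous.prodMk_left τ).tendsto' 0 _ rfl).mono_left nhdsWithin_le_nhds
      exact (continuousAt_fluxReg a hG hw).tendsto.comp h1
  refine ((hlim.const_mul (1 / 2 : ℂ)).add_const (G (a, 0))).congr' ?_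
  filter_upwards [hev] with s hs
  exact (surf_eq a hG hs.1).symm

end FluxLimit

/-! ### Change of variables from ℝ³ to spheroidal coordinates -/

section ChangeOfVariables

/-- The parameter strip `s > 0`, `|τ| < π / 2`. -/
def strip : Set (ℝ × ℝ) := Ioi 0 ×ˢ Ioo (-(Real.pi / 2)) (Real.pi / 2)

theorem measurableSet_strip : MeasurableSet strip := measurableSet_Ioi.prod measurableSet_Ioo

theorem cos_pos_of_mem_strip {p : ℝ × ℝ} (hp : p ∈ strip) : 0 < Real.cos p.2 :=
  Real.cos_pos_of_mem_Ioo hp.2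

theorem sph_fst_pos {a : ℝ} (ha : 0 < a) {p : ℝ × ℝ} (hp : p ∈ strip) : 0 < (sph a p).1 :=
  mul_pos (mul_pos ha (Real.cosh_pos _)) (cos_pos_of_mem_strip hp)

theorem gamS_re (p : ℝ × ℝ) : (gamS p).re = Real.sinh p.1 := by
  simp [gamS, -Complex.ofReal_sinh]

theorem gamS_im (p : ℝ × ℝ) : (gamS p).im = Real.sin p.2 := by
  simp [gamS, -Complex.ofReal_sinh, -Complex.ofReal_sin]

/-- γ² is polynomial in (ρ, ζ). This yields both injectivity of the coordinates, the opposite root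
having negative real part, and the identification of γ with `gam`. -/
theorem sq_gamS (a : ℝ) (p : ℝ × ℝ) : ((a : ℂ) * gamS p) ^ 2 =
    (((sph a p).1 ^ 2 + (sph a p).2 ^ 2 - a ^ 2 : ℝ) : ℂ) +
      2 * Complex.I * a * (sph a p).2 := by
  have h1 : (Real.cosh p.1 : ℂ) ^ 2 = 1 + (Real.sinh p.1 : ℂ) ^ 2 := by
    exact_mod_cast (by rw [Real.cosh_sq]; ring : Real.cosh p.1 ^ 2 = 1 + Real.sinh p.1 ^ 2)
  have h2 : (Real.cos p.2 : ℂ) ^ 2 = 1 - (Real.sin p.2 : ℂ) ^ 2 := by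
    exact_mod_cast Real.cos_sq' p.2
  simp only [gamS, sph, Complex.ofReal_add, Complex.ofReal_sub, Complex.ofReal_mul,
    Complex.ofReal_pow]
  generalize (Real.cosh p.1 : ℂ) = C at *
  generalize (Real.sinh p.1 : ℂ) = S at *
  generalize (Real.cos p.2 : ℂ) = c at *
  generalize (Real.sin p.2 : ℂ) = t at *
  linear_combination (a ^ 2 * t ^ 2 : ℂ) * Complex.I_sq - (a ^ 2 * c ^ 2 : ℂ) * h1 -
    (a ^ 2 * (1 + S ^ 2) : ℂ) * h2

theorem injOn_sph {a : ℝ} (ha : 0 < a) : InjOn (sph a) strip := by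
  intro p hp q hq h
  have h1 : ((a : ℂ) * gamS p) ^ 2 = ((a : ℂ) * gamS q) ^ 2 := by rw [sq_gamS, sq_gamS, h]
  have ha' : (a : ℂ) ≠ 0 := by exact_mod_cast ha.ne'
  rw [mul_pow, mul_pow] at h1
  have hp1 : 0 < Real.sinh p.1 := Real.sinh_pos_iff.2 hp.1
  have hq1 : 0 < Real.sinh q.1 := Real.sinh_pos_iff.2 hq.1
  rcases sq_eq_sq_iff_eq_or_eq_neg.1 (mul_left_cancel₀ (pow_ne_zero 2 ha') h1) with h2 | h2
  · have hre := congrArg Complex.re h2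
    have him := congrArg Complex.im h2
    rw [gamS_re, gamS_re] at hre
    rw [gamS_im, gamS_im] at him
    exact Prod.ext (Real.sinh_injective hre)
      (Real.injOn_sin (Ioo_subset_Icc_self hp.2) (Ioo_subset_Icc_self hq.2) him)
  · have hre := congrArg Complex.re h2
    rw [Complex.neg_re, gamS_re, gamS_re] at hre
    linarith

/-- The coordinates p, q are recovered as real and imaginary parts of the square root of ρ² + ζ² -
a² + 2iaζ with positive real part; ζ ≠ 0 excludes a purely imaginary root. -/
theorem mem_image_sph {a : ℝ} (ha : 0 < a) {v : ℝ × ℝ} (h1 : 0 < v.1) (h2 : v.2 ≠ 0) :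
    v ∈ sph a '' strip := by
  obtain ⟨w, hw, hwp⟩ : ∃ w : ℂ, w ^ 2 = ((v.1 ^ 2 + v.2 ^ 2 - a ^ 2 : ℝ) : ℂ) +
      ((2 * a * v.2 : ℝ) : ℂ) * Complex.I ∧ 0 < w.re := by
    obtain ⟨w, hw⟩ := IsAlgClosed.exists_pow_nat_eq (((v.1 ^ 2 + v.2 ^ 2 - a ^ 2 : ℝ) : ℂ) +
      ((2 * a * v.2 : ℝ) : ℂ) * Complex.I) (n := 2) two_pos
    rcases lt_trichotomy w.re 0 with h | h | h
    · exact ⟨-w, by rw [neg_sq, hw], by rw [Complex.neg_re]; linarith⟩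
    · exfalso
      have him := congrArg Complex.im hw
      simp [pow_two, h] at him
      rcases him with h' | h'
      · exact ha.ne' h'
      · exact h2 h'
    · exact ⟨w, hw, h⟩
  have hre := congrArg Complex.re hw
  have him := congrArg Complex.im hw
  simp only [pow_two, Complex.mul_re, Complex.mul_im, Complex.add_re, Complex.add_im,
    Complex.ofReal_re, Complex.ofReal_im, Complex.I_re, Complex.I_im, mul_zero, mul_one, sub_zero,
    add_zero, zero_add] at hre him
  have hprod : w.re * w.im = a * v.2 := by linarith
  -- This is the defining relation of ρ; as ρ > 0 it forces |q| < a, so that the arcsine is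
  -- available.
  have hfac : (a ^ 2 + w.re ^ 2) * (a ^ 2 - w.im ^ 2) = (a * v.1) ^ 2 := by
    linear_combination a ^ 2 * hre - (w.re * w.im + a * v.2) * hprod
  have hpos : 0 < a ^ 2 - w.im ^ 2 := by
    by_contra! h
    nlinarith [mul_pos ha h1, sq_nonneg w.re, pow_pos ha 2, pow_pos (mul_pos ha h1) 2]
  have hlt : |w.im / a| < 1 := by
    rw [abs_div, abs_of_pos ha, div_lt_one ha]
    exact abs_lt_of_sq_lt_sq (by linarith) ha.le
  have hlt' := abs_lt.1 hlt
  set p : ℝ × ℝ := (Real.arsinh (w.re / a), Real.arcsin (w.im / a)) with hpdef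
  have hs : Real.sinh p.1 = w.re / a := Real.sinh_arsinh _
  have ht : Real.sin p.2 = w.im / a := Real.sin_arcsin hlt'.1.le hlt'.2.le
  have hp : p ∈ strip := by
    refine ⟨?_, ?_, ?_⟩
    · exact Real.arsinh_pos_iff.2 (div_pos hwp ha)
    · exact Real.neg_pi_div_two_lt_arcsin.2 hlt'.1
    · exact Real.arcsin_lt_pi_div_two.2 hlt'.2
  refine ⟨p, hp, Prod.ext ?_ ?_⟩
  · refine (sq_eq_sq₀ (sph_fst_pos ha hp).le h1.le).1 ?_
    simp only [sph]
    rw [mul_pow, mul_pow, Real.cosh_sq, Real.cos_sq', hs, ht]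
    field_simp
    linear_combination hfac
  · simp only [sph]
    rw [hs, ht]
    field_simp
    linear_combination hprod

theorem hasFDerivAt_sph (a : ℝ) (p : ℝ × ℝ) : HasFDerivAt (sph a)
    (Matrix.toLin (.finTwoProd ℝ) (.finTwoProd ℝ)
      !![a * Real.sinh p.1 * Real.cos p.2, -(a * Real.cosh p.1 * Real.sin p.2);
        a * Real.cosh p.1 * Real.sin p.2,
        a * Real.sinh p.1 * Real.cos p.2]).toContinuousLinearMap p := by
  have hd : HasFDerivAt (sph a) _ p :=
    ((contDiff_sph a (m := 1)).differentiable one_ne_zero p).hasFDerivAt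
  refine hd.congr_fderiv ?_
  have h1 := HasFDerivAt.comp_hasDerivAt (f := fun s => (s, p.2)) p.1 hd
    ((hasDerivAt_id p.1).prodMk (hasDerivAt_const p.1 p.2))
  have h2 := HasFDerivAt.comp_hasDerivAt (f := fun τ => (p.1, τ)) p.2 hd
    ((hasDerivAt_const p.2 p.1).prodMk (hasDerivAt_id p.2))
  have e1 := h1.unique (hasDerivAt_sph_fst a p.1 p.2)
  have e2 := h2.unique (hasDerivAt_sph_snd a p.1 p.2)
  rw [Matrix.toLin_finTwoProd_toContinuousLinearMap]
  refine ContinuousLinearMap.ext fun w => ?_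
  have hw : w = w.1 • ((1 : ℝ), (0 : ℝ)) + w.2 • ((0 : ℝ), (1 : ℝ)) := by simp
  rw [hw, map_add, map_smul, map_smul, e1, e2]
  ext <;> simp [sphS, sphT] <;> ring

theorem lintegral_halfPlane {a : ℝ} (ha : 0 < a) (k : ℝ × ℝ → ENNReal) :
    ∫⁻ v in Ioi 0 ×ˢ univ, k v =
      ∫⁻ p in strip, ENNReal.ofReal (a ^ 2 * (Real.sinh p.1 ^ 2 + Real.sin p.2 ^ 2)) *
        k (sph a p) := by
  have hae : (Ioi 0 ×ˢ univ : Set (ℝ × ℝ)) =ᵐ[volume] sph a '' strip := by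
    -- The coordinates can miss points of the half-plane only on the line ζ = 0, a null set.
    have hnull : ∀ᵐ v : ℝ × ℝ, v.2 ≠ 0 := by
      have h := (Measure.quasiMeasurePreserving_snd (μ := (volume : Measure ℝ))
        (ν := (volume : Measure ℝ))).ae (Measure.ae_ne volume (0 : ℝ))
      exact h
    filter_upwards [hnull] with v hv
    refine propext ⟨fun h => mem_image_sph ha h.1 hv, ?_⟩
    rintro ⟨p, hp, rfl⟩
    exact ⟨sph_fst_pos ha hp, mem_univ _⟩
  rw [setLIntegral_congr hae, lintegral_image_eq_lintegral_abs_det_fderiv_mul volume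
    measurableSet_strip (fun p _ => (hasFDerivAt_sph a p).hasFDerivWithinAt) (injOn_sph ha)]
  refine setLIntegral_congr_fun measurableSet_strip fun p _ => ?_
  congr 2
  rw [LinearMap.det_toContinuousLinearMap, LinearMap.det_toLin, Matrix.det_fin_two_of]
  have h1 := Real.cosh_sq p.1
  have h2 := Real.cos_sq' p.2
  have e : a * Real.sinh p.1 * Real.cos p.2 * (a * Real.sinh p.1 * Real.cos p.2) -
      -(a * Real.cosh p.1 * Real.sin p.2) * (a * Real.cosh p.1 * Real.sin p.2) =
      a ^ 2 * (Real.sinh p.1 ^ 2 + Real.sin p.2 ^ 2) := by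
    linear_combination a ^ 2 * Real.sinh p.1 ^ 2 * h2 + a ^ 2 * Real.sin p.2 ^ 2 * h1
  rw [e, abs_of_nonneg (by positivity)]

/-- The axial coordinate comes first because `piFinSuccAbove` splits off index 2. -/
theorem measurePreserving_frame {e₁ e₂ n : R3} (he : Orthonormal ℝ ![e₁, e₂, n]) :
    MeasurePreserving (fun p : ℝ × (ℝ × ℝ) => p.2.1 • e₁ + p.2.2 • e₂ + p.1 • n) := by
  obtain ⟨b, h0, h1, h2⟩ := exists_orthonormalBasis_eq he
  have m1 : MeasurePreserving (Prod.map (id : ℝ → ℝ) (MeasurableEquiv.finTwoArrow (α := ℝ)).symm)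
      volume volume :=
    (MeasurePreserving.id volume).prod (volume_preserving_finTwoArrow ℝ).symm
  have m2 := (volume_preserving_piFinSuccAbove (fun _ : Fin 3 => ℝ) 2).symm
  have m := b.measurePreserving_repr_symm.comp
    ((PiLp.volume_preserving_toLp (Fin 3)).comp (m2.comp m1))
  convert! m using 1
  ext1 p
  simp only [Function.comp_apply]
  rw [← b.sum_repr_symm, Fin.sum_univ_three, h0, h1, h2]
  rfl

theorem continuous_cylPoint (e₁ e₂ n : R3) :
    Continuous fun q : ℝ × (ℝ × ℝ) => cylPoint e₁ e₂ n q.1 q.2 := by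
  have := (contDiff_radial e₁ e₂ (m := 0)).continuous
  simp only [cylPoint_apply]
  fun_prop

theorem continuous_cylPoint_sph (e₁ e₂ n : R3) (a : ℝ) :
    Continuous fun q : ℝ × (ℝ × ℝ) => cylPoint e₁ e₂ n q.1 (sph a q.2) := by
  have := (contDiff_radial e₁ e₂ (m := 0)).continuous
  have := continuous_sph a
  simp only [cylPoint_apply]
  fun_prop

/-- The angle is outermost so that spheroidal coordinates can be introduced in the half-plane at
fixed θ; with nonnegative functions the exchanges of order need only measurability. -/
theorem lintegral_frame {e₁ e₂ n : R3} (he : Orthonormal ℝ ![e₁, e₂, n]) {g : R3 → ENNReal}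
    (hg : Measurable g) :
    ∫⁻ x, g x = ∫⁻ θ in Ioo (-Real.pi) Real.pi, ∫⁻ v in Ioi 0 ×ˢ univ,
      ENNReal.ofReal v.1 * g (cylPoint e₁ e₂ n θ v) := by
  have hcyl := continuous_cylPoint e₁ e₂ n
  have hmeas : Measurable fun q : ℝ × (ℝ × ℝ) =>
      ENNReal.ofReal q.2.1 * g (cylPoint e₁ e₂ n q.1 q.2) :=
    (measurable_snd.fst.ennreal_ofReal).mul (hg.comp hcyl.measurable)
  have hpm := measurePreserving_frame he
  have hgm : Measurable fun p : ℝ × (ℝ × ℝ) => g (p.2.1 • e₁ + p.2.2 • e₂ + p.1 • n) :=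
    hg.comp hpm.measurable
  rw [← hpm.lintegral_comp hg, Measure.volume_eq_prod, lintegral_prod _ hgm.aemeasurable]
  calc ∫⁻ ζ : ℝ, ∫⁻ u : ℝ × ℝ, g (u.1 • e₁ + u.2 • e₂ + ζ • n)
      = ∫⁻ ζ : ℝ, ∫⁻ θ in Ioo (-Real.pi) Real.pi, ∫⁻ ρ in Ioi (0 : ℝ),
          ENNReal.ofReal ρ * g (cylPoint e₁ e₂ n θ (ρ, ζ)) := by
        refine lintegral_congr fun ζ => ?_
        rw [← lintegral_comp_polarCoord_symm]
        have e : polarCoord.target = Ioi (0 : ℝ) ×ˢ Ioo (-Real.pi) Real.pi := rfl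
        rw [e, Measure.volume_eq_prod, ← Measure.prod_restrict]
        have hfun : ∀ q : ℝ × ℝ, ENNReal.ofReal q.1 • g ((polarCoord.symm q).1 • e₁ +
            (polarCoord.symm q).2 • e₂ + ζ • n) =
            ENNReal.ofReal q.1 * g (cylPoint e₁ e₂ n q.2 (q.1, ζ)) := by
          intro q
          simp only [polarCoord_symm_apply, cylPoint_apply, radial, smul_eq_mul, smul_add,
            smul_smul]
        simp only [hfun]
        refine lintegral_prod_symm _ (Measurable.aemeasurable ?_)
        exact hmeas.comp (measurable_snd.prodMk (measurable_fst.prodMk measurable_const))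
    _ = ∫⁻ θ in Ioo (-Real.pi) Real.pi, ∫⁻ ζ : ℝ, ∫⁻ ρ in Ioi (0 : ℝ),
          ENNReal.ofReal ρ * g (cylPoint e₁ e₂ n θ (ρ, ζ)) := by
        refine lintegral_lintegral_swap (Measurable.aemeasurable ?_)
        refine Measurable.lintegral_prod_right' (f := fun q : (ℝ × ℝ) × ℝ =>
          ENNReal.ofReal q.2 * g (cylPoint e₁ e₂ n q.1.2 (q.2, q.1.1))) ?_
        exact hmeas.comp (measurable_fst.snd.prodMk (measurable_snd.prodMk measurable_fst.fst))
    _ = _ := by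
        refine lintegral_congr fun θ => ?_
        rw [Measure.volume_eq_prod, ← Measure.prod_restrict, Measure.restrict_univ]
        refine (lintegral_prod_symm (fun v : ℝ × ℝ => ENNReal.ofReal v.1 *
          g (cylPoint e₁ e₂ n θ v)) (Measurable.aemeasurable ?_)).symm
        exact hmeas.comp (measurable_const.prodMk measurable_id)

/-- The Jacobian of oblate spheroidal coordinates. -/
noncomputable def jac (a : ℝ) (p : ℝ × ℝ) : ℝ :=
  a ^ 2 * (Real.sinh p.1 ^ 2 + Real.sin p.2 ^ 2) * (sph a p).1

theorem continuous_jac (a : ℝ) : Continuous (jac a) := by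
  have := continuous_sph a
  unfold jac
  fun_prop

theorem jac_nonneg {a : ℝ} (ha : 0 < a) {p : ℝ × ℝ} (hp : p ∈ strip) : 0 ≤ jac a p :=
  mul_nonneg (by positivity) (sph_fst_pos ha hp).le

/-- The angle and the spheroidal parameters, with the Jacobian as a density. -/
noncomputable def sphMeasure (a : ℝ) : Measure (ℝ × (ℝ × ℝ)) :=
  ((volume.restrict (Ioo (-Real.pi) Real.pi)).prod (volume.restrict strip)).withDensity
    fun q => ENNReal.ofReal (jac a q.2)

/-- In this form the change of variables transfers integrability and null sets as well as integrals.
-/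
theorem measurePreserving_spheroidal {a : ℝ} (ha : 0 < a) {e₁ e₂ n : R3}
    (he : Orthonormal ℝ ![e₁, e₂, n]) :
    MeasurePreserving (fun q : ℝ × (ℝ × ℝ) => cylPoint e₁ e₂ n q.1 (sph a q.2))
      (sphMeasure a) volume := by
  have hc := continuous_cylPoint_sph e₁ e₂ n a
  have hj : Measurable fun q : ℝ × (ℝ × ℝ) => ENNReal.ofReal (jac a q.2) :=
    ((continuous_jac a).measurable.comp measurable_snd).ennreal_ofReal
  refine ⟨hc.measurable, Measure.ext_of_lintegral _ fun g hg => ?_⟩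
  have hgc : Measurable fun q : ℝ × (ℝ × ℝ) => g (cylPoint e₁ e₂ n q.1 (sph a q.2)) :=
    hg.comp hc.measurable
  rw [lintegral_map hg hc.measurable, sphMeasure,
    lintegral_withDensity_eq_lintegral_mul _ hj hgc,
    lintegral_prod _ (hj.mul hgc).aemeasurable, lintegral_frame he hg]
  refine lintegral_congr fun θ => ?_
  rw [lintegral_halfPlane ha]
  refine setLIntegral_congr_fun measurableSet_strip fun p hp => ?_
  simp only [Pi.mul_apply, jac]
  rw [← mul_assoc, ← ENNReal.ofReal_mul (by positivity)]

theorem integral_eq_integral_strip {a : ℝ} (ha : 0 < a) {e₁ e₂ n : R3}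
    (he : Orthonormal ℝ ![e₁, e₂, n]) {g : R3 → ℂ} (hg : Integrable g) :
    ∫ x, g x = ∫ p in strip, (2 * Real.pi * jac a p : ℝ) * meanFn e₁ e₂ n g (sph a p) := by
  have hc := continuous_cylPoint_sph e₁ e₂ n a
  have hj : Measurable fun q : ℝ × (ℝ × ℝ) => ENNReal.ofReal (jac a q.2) :=
    ((continuous_jac a).measurable.comp measurable_snd).ennreal_ofReal
  have hmp := measurePreserving_spheroidal ha he
  have hi : Integrable (fun q : ℝ × (ℝ × ℝ) => g (cylPoint e₁ e₂ n q.1 (sph a q.2)))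
      (sphMeasure a) := hmp.integrable_comp_of_integrable hg
  have hlt : ∀ᵐ q ∂((volume.restrict (Ioo (-Real.pi) Real.pi)).prod (volume.restrict strip)),
      ENNReal.ofReal (jac a q.2) < ⊤ := Eventually.of_forall fun _ => ENNReal.ofReal_lt_top
  have h1 : ∫ x, g x = ∫ q, g (cylPoint e₁ e₂ n q.1 (sph a q.2)) ∂(sphMeasure a) := by
    conv_lhs => rw [← hmp.map_eq]
    rw [integral_map hc.measurable.aemeasurable]
    rw [hmp.map_eq]
    exact hg.aestronglyMeasurable
  rw [sphMeasure, integrable_withDensity_iff_integrable_smul' hj hlt] at hi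
  rw [h1, sphMeasure, integral_withDensity_eq_integral_toReal_smul hj hlt, integral_prod_symm _ hi]
  refine setIntegral_congr_fun measurableSet_strip fun p hp => ?_
  have hpi := Real.pi_pos
  -- Polar coordinates use (-π, π), the circle mean uses [0, 2π]; periodicity reconciles them.
  have hper : Function.Periodic (fun θ => g (cylPoint e₁ e₂ n θ (sph a p))) (2 * Real.pi) := by
    intro θ
    simp [cylPoint_apply, radial]
  have hshift := hper.intervalIntegral_add_eq (-Real.pi) 0
  rw [show -Real.pi + 2 * Real.pi = Real.pi by ring, zero_add] at hshift
  dsimp only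
  rw [integral_smul, ENNReal.toReal_ofReal (jac_nonneg ha hp), meanFn_eq, ← hshift,
    intervalIntegral.integral_of_le (by linarith), integral_Ioc_eq_integral_Ioo]
  simp only [Complex.real_smul]
  push_cast
  field_simp

end ChangeOfVariables

/-! ### Density of C_c^∞ in C¹ on compact sets, and uniqueness -/

section Density

/-- Mollification by a bump whose radius is taken from the uniform continuity of `h` and of its
derivative; differentiation of the convolution falls on `h`. -/
theorem exists_contDiff_approx_of_hasCompactSupport {h : R3 → ℂ} (hh : ContDiff ℝ 1 h)
    (hs : HasCompactSupport h) {δ : ℝ} (hδ : 0 < δ) :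
    ∃ g : R3 → ℂ, ContDiff ℝ ∞ g ∧ HasCompactSupport g ∧
      ∀ x, dist (g x) (h x) ≤ δ ∧ dist (fderiv ℝ g x) (fderiv ℝ h x) ≤ δ := by
  have hc := hh.continuous
  have hc' := hh.continuous_fderiv one_ne_zero
  obtain ⟨r₁, h₁, H₁⟩ := Metric.uniformContinuous_iff.1
    (hs.uniformContinuous_of_continuous hc) δ hδ
  obtain ⟨r₂, h₂, H₂⟩ := Metric.uniformContinuous_iff.1
    ((hs.fderiv ℝ).uniformContinuous_of_continuous hc') δ hδ
  have hr : 0 < min r₁ r₂ := lt_min h₁ h₂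
  let φ : ContDiffBump (0 : R3) := ⟨min r₁ r₂ / 2, min r₁ r₂, half_pos hr, half_lt_self hr⟩
  have hloc : LocallyIntegrable (φ.normed volume) (volume : Measure R3) :=
    φ.continuous_normed.locallyIntegrable
  refine ⟨convolution (φ.normed volume) h (ContinuousLinearMap.lsmul ℝ ℝ) volume, ?_, ?_,
    fun x => ⟨?_, ?_⟩⟩
  · exact φ.hasCompactSupport_normed.contDiff_convolution_left _ φ.contDiff_normed
      hc.locallyIntegrable
  · exact φ.hasCompactSupport_normed.convolution _ hs
  · refine φ.dist_normed_convolution_le hc.aestronglyMeasurable fun y hy => (H₁ ?_).le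
    exact lt_of_lt_of_le hy (min_le_left _ _)
  · have hd := hs.hasFDerivAt_convolution_right (ContinuousLinearMap.lsmul ℝ ℝ) hloc hh x
    have he : convolution (φ.normed volume) (fderiv ℝ h)
        (ContinuousLinearMap.precompR R3 (ContinuousLinearMap.lsmul ℝ ℝ)) volume x =
        convolution (φ.normed volume) (fderiv ℝ h) (ContinuousLinearMap.lsmul ℝ ℝ) volume x := by
      simp only [convolution_def]
      refine integral_congr_ae (Eventually.of_forall fun t => ?_)
      ext w
      simp [ContinuousLinearMap.precompR_apply]
    rw [hd.fderiv, he]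
    refine φ.dist_normed_convolution_le hc'.aestronglyMeasurable fun y hy => (H₂ ?_).le
    exact lt_of_lt_of_le hy (min_le_right _ _)

theorem exists_contDiff_approx {f : R3 → ℂ} (hf : ContDiff ℝ 1 f) {K : Set R3} (hK : IsCompact K)
    {δ : ℝ} (hδ : 0 < δ) :
    ∃ g : R3 → ℂ, ContDiff ℝ ∞ g ∧ HasCompactSupport g ∧
      ∀ x ∈ K, dist (f x) (g x) ≤ δ ∧ dist (fderiv ℝ f x) (fderiv ℝ g x) ≤ δ := by
  obtain ⟨R, hR0, hR⟩ := hK.isBounded.exists_pos_norm_le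
  -- The cutoff is 1 on a neighbourhood of each point of `K`, so the derivative there is unchanged
  -- too.
  let χ : ContDiffBump (0 : R3) := ⟨R + 1, R + 2, by linarith, by linarith⟩
  have hh : ContDiff ℝ 1 fun x => χ x • f x := χ.contDiff.smul hf
  have hs : HasCompactSupport fun x => χ x • f x := χ.hasCompactSupport.smul_right
  obtain ⟨g, hg, hgs, H⟩ := exists_contDiff_approx_of_hasCompactSupport hh hs hδ
  refine ⟨g, hg, hgs, fun x hx => ?_⟩
  have hev : (fun x => χ x • f x) =ᶠ[𝓝 x] f := by
    have : Metric.ball (0 : R3) (R + 1) ∈ 𝓝 x :=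
      Metric.isOpen_ball.mem_nhds (by rw [mem_ball_zero_iff]; linarith [hR x hx])
    filter_upwards [this] with z hz
    rw [χ.one_of_mem_closedBall (Metric.ball_subset_closedBall hz), one_smul]
  have h1 := H x
  rw [hev.eq_of_nhds, hev.fderiv_eq] at h1
  rwa [dist_comm (f x), dist_comm (fderiv ℝ f x)]

/-- A distributional Laplacian has at most one bounded extension to `C¹`. -/
theorem IsDistribLaplacian.unique {u : R3 → ℂ} {T₁ T₂ : C1 →ₗ[ℂ] ℂ}
    (h₁ : IsDistribLaplacian u T₁) (h₂ : IsDistribLaplacian u T₂) : T₁ = T₂ := by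
  obtain ⟨-, ⟨K₁, hK₁, C₁, H₁⟩, hd₁⟩ := h₁
  obtain ⟨-, ⟨K₂, hK₂, C₂, H₂⟩, hd₂⟩ := h₂
  ext f
  rw [← sub_eq_zero, ← norm_le_zero_iff]
  have key : ∀ δ : ℝ, 0 < δ → ‖T₁ f - T₂ f‖ ≤ (C₁ + C₂) * δ := by
    intro δ hδ
    obtain ⟨g, hg, hgs, hfg⟩ := exists_contDiff_approx f.2 (hK₁.union hK₂) hδ
    let g' : C1 := ⟨g, show ContDiff ℝ 1 g from contDiff_infty.1 hg 1⟩
    have e : T₁ f - T₂ f = T₁ (f - g') - T₂ (f - g') := by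
      rw [map_sub, map_sub, hd₁ g' hg hgs, hd₂ g' hg hgs]
      ring
    have hb : ∀ x ∈ K₁ ∪ K₂, ‖((f - g' : C1) : R3 → ℂ) x‖ ≤ δ ∧
        ‖fderiv ℝ ((f - g' : C1) : R3 → ℂ) x‖ ≤ δ := by
      intro x hx
      have hfd : DifferentiableAt ℝ (f : R3 → ℂ) x :=
        ContDiff.differentiable (n := 1) f.2 one_ne_zero x
      have hgd : DifferentiableAt ℝ g x := ContDiff.differentiable hg (by simp) x
      have ec : ((f - g' : C1) : R3 → ℂ) = (f : R3 → ℂ) - g := rfl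
      rw [ec, fderiv_sub hfd hgd, Pi.sub_apply, ← dist_eq_norm, ← dist_eq_norm]
      exact hfg x hx
    rw [e]
    refine (norm_sub_le _ _).trans ?_
    rw [add_mul]
    exact add_le_add (H₁ _ δ hδ.le fun x hx => hb x (Or.inl hx))
      (H₂ _ δ hδ.le fun x hx => hb x (Or.inr hx))
  have hlim : Tendsto (fun δ : ℝ => (C₁ + C₂) * δ) (𝓝[>] 0) (𝓝 0) :=
    ((continuous_const.mul continuous_id).tendsto' 0 0 (by simp)).mono_left nhdsWithin_le_nhds
  exact ge_of_tendsto hlim (by filter_upwards [self_mem_nhdsWithin] with δ hδ using key δ hδ)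

theorem IsSingularSource.unique {y : R3} {T₁ T₂ : C1 →ₗ[ℂ] ℂ}
    (h₁ : IsSingularSource y T₁) (h₂ : IsSingularSource y T₂) : T₁ = T₂ := by
  obtain ⟨S₁, hS₁, hT₁⟩ := h₁
  obtain ⟨S₂, hS₂, hT₂⟩ := h₂
  ext f
  refine tendsto_nhds_unique (hT₁ f) ((hT₂ f).congr' ?_)
  filter_upwards [self_mem_nhdsWithin] with ε hε
  rw [(hS₁ ε hε).unique (hS₂ ε hε)]

end Density

/-! ### The potential in spheroidal coordinates and its local integrability -/

section Potential

theorem sum_toC3_sq (x y : R3) :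
    ∑ j, toC3 x y j ^ 2 = ((‖x‖ ^ 2 - ‖y‖ ^ 2 : ℝ) : ℂ) + 2 * Complex.I * (inner ℝ x y : ℝ) := by
  rw [EuclideanSpace.real_norm_sq_eq, EuclideanSpace.real_norm_sq_eq, PiLp.inner_apply]
  simp only [Fin.sum_univ_three, toC3, RCLike.inner_apply, conj_trivial]
  push_cast
  linear_combination ((y 0 : ℂ) ^ 2 + (y 1 : ℂ) ^ 2 + (y 2 : ℂ) ^ 2) * Complex.I_sq

theorem inner_radial_axis {e₁ e₂ n : R3} (he : Orthonormal ℝ ![e₁, e₂, n]) (θ : ℝ) :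
    inner ℝ (radial e₁ e₂ θ) n = (0 : ℝ) := by
  have h1 : inner ℝ e₁ n = (0 : ℝ) := by simpa using (orthonormal_iff_ite.1 he 0 2)
  have h2 : inner ℝ e₂ n = (0 : ℝ) := by simpa using (orthonormal_iff_ite.1 he 1 2)
  simp [radial, inner_add_left, inner_smul_left, h1, h2]

theorem norm_axis {e₁ e₂ n : R3} (he : Orthonormal ℝ ![e₁, e₂, n]) : ‖n‖ = 1 := by
  simpa using he.1 2

theorem norm_cylPoint_sq {e₁ e₂ n : R3} (he : Orthonormal ℝ ![e₁, e₂, n]) (θ : ℝ) (v : ℝ × ℝ) :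
    ‖cylPoint e₁ e₂ n θ v‖ ^ 2 = v.1 ^ 2 + v.2 ^ 2 := by
  rw [cylPoint_apply, norm_add_sq_real, norm_smul, norm_smul, norm_radial he, norm_axis he,
    inner_smul_left, inner_smul_right, inner_radial_axis he]
  simp

theorem inner_cylPoint_axis {e₁ e₂ n : R3} (he : Orthonormal ℝ ![e₁, e₂, n]) (θ : ℝ) (v : ℝ × ℝ)
    (a : ℝ) : inner ℝ (cylPoint e₁ e₂ n θ v) (a • n) = a * v.2 := by
  rw [cylPoint_apply, inner_add_left, inner_smul_left, inner_smul_right, inner_radial_axis he,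
    inner_smul_left, inner_smul_right, real_inner_self_eq_norm_sq, norm_axis he]
  simp [mul_comm]

/-- Both sides have the same square, and sinh s > 0 selects the branch of the principal root. -/
theorem gam_cylPoint {a : ℝ} (ha : 0 < a) {e₁ e₂ n : R3} (he : Orthonormal ℝ ![e₁, e₂, n])
    (θ : ℝ) {p : ℝ × ℝ} (hp : p ∈ strip) :
    gam (toC3 (cylPoint e₁ e₂ n θ (sph a p)) (a • n)) = a * gamS p := by
  have h : ∑ j, toC3 (cylPoint e₁ e₂ n θ (sph a p)) (a • n) j ^ 2 = ((a : ℂ) * gamS p) ^ 2 := by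
    rw [sum_toC3_sq, sq_gamS, norm_cylPoint_sq he, inner_cylPoint_axis he, norm_smul, norm_axis he,
      Real.norm_of_nonneg ha.le]
    push_cast
    ring
  rw [gam, h, Complex.sqrt]
  refine Complex.sq_cpow_two_inv ?_
  rw [Complex.re_ofReal_mul, gamS_re]
  exact mul_pos ha (Real.sinh_pos_iff.2 hp.1)

theorem measurable_gam (y : R3) : Measurable fun x => gam (toC3 x y) := by
  unfold gam toC3 Complex.sqrt
  fun_prop

theorem measurable_phi (y : R3) : Measurable (phi y) := by
  have := measurable_gam y
  unfold phi
  fun_prop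

theorem measurable_phiReg (ε : ℝ) (y : R3) : Measurable (phiReg ε y) := by
  unfold phiReg
  exact Measurable.ite (measurableSet_lt measurable_const
    (Complex.measurable_re.comp (measurable_gam y))) (measurable_phi y) measurable_const

/-- Here |x|² = a² sinh² s + a² cos² τ, so a sinh s is the minor semi-axis. Bounded sets of points
therefore have s bounded above. -/
theorem mul_sinh_le_norm_cylPoint {a : ℝ} {e₁ e₂ n : R3}
    (he : Orthonormal ℝ ![e₁, e₂, n]) (θ : ℝ) (p : ℝ × ℝ) :
    a * Real.sinh p.1 ≤ ‖cylPoint e₁ e₂ n θ (sph a p)‖ := by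
  refine le_of_abs_le (abs_le_of_sq_le_sq ?_ (norm_nonneg _))
  rw [norm_cylPoint_sq he]
  simp only [sph]
  have h1 := Real.cosh_sq p.1
  have h2 := Real.cos_sq' p.2
  have : (a * Real.cosh p.1 * Real.cos p.2) ^ 2 + (a * Real.sinh p.1 * Real.sin p.2) ^ 2 =
      (a * Real.sinh p.1) ^ 2 + (a * Real.cos p.2) ^ 2 := by
    linear_combination a ^ 2 * Real.cos p.2 ^ 2 * h1 + a ^ 2 * Real.sinh p.1 ^ 2 * h2
  rw [this]
  nlinarith [sq_nonneg (a * Real.cos p.2)]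

/-- The Jacobian contributes |γ|² ρ and the potential 1/(4π|γ|): the singularity of φ cancels and a
continuous function remains. -/
theorem norm_jac_mul_phi {a : ℝ} (ha : 0 < a) {e₁ e₂ n : R3} (he : Orthonormal ℝ ![e₁, e₂, n])
    (θ : ℝ) {p : ℝ × ℝ} (hp : p ∈ strip) :
    ‖jac a p • phi (a • n) (cylPoint e₁ e₂ n θ (sph a p))‖ =
      (4 * Real.pi)⁻¹ * a * ‖gamS p‖ * (sph a p).1 := by
  have hw : 0 < ‖gamS p‖ := norm_pos_iff.2 (gamS_ne_zero hp.1)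
  have hpi := Real.pi_pos
  rw [norm_smul, Real.norm_of_nonneg (jac_nonneg ha hp), phi, gam_cylPoint ha he θ hp, jac,
    ← norm_gamS_sq]
  simp only [norm_div, norm_neg, norm_one, norm_mul, Complex.norm_real,
    Real.norm_of_nonneg hpi.le, Real.norm_of_nonneg ha.le, Complex.norm_ofNat]
  field_simp

theorem locallyIntegrable_phi {a : ℝ} (ha : 0 < a) {e₁ e₂ n : R3}
    (he : Orthonormal ℝ ![e₁, e₂, n]) : LocallyIntegrable (phi (a • n)) := by
  rw [locallyIntegrable_iff]
  intro K hK
  obtain ⟨R, hR0, hR⟩ := hK.isBounded.exists_pos_norm_le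
  have hKm : MeasurableSet K := hK.isClosed.measurableSet
  rw [← integrable_indicator_iff hKm]
  have hmp := measurePreserving_spheroidal ha he
  have hmeas : Measurable (K.indicator (phi (a • n))) := (measurable_phi _).indicator hKm
  have hj : Measurable fun q : ℝ × (ℝ × ℝ) => ENNReal.ofReal (jac a q.2) :=
    ((continuous_jac a).measurable.comp measurable_snd).ennreal_ofReal
  rw [← hmp.integrable_comp hmeas.aestronglyMeasurable, sphMeasure,
    integrable_withDensity_iff_integrable_smul' hj
      (Eventually.of_forall fun _ => ENNReal.ofReal_lt_top)]
  -- Points with s > `S` have norm above `R`, so `K` lies in the compact parameter box `B`.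
  set S := Real.arsinh (R / a) with hS
  set B : Set (ℝ × (ℝ × ℝ)) := Icc (-Real.pi) Real.pi ×ˢ
    (Icc 0 S ×ˢ Icc (-(Real.pi / 2)) (Real.pi / 2)) with hB
  have hBm : MeasurableSet B := measurableSet_Icc.prod (measurableSet_Icc.prod measurableSet_Icc)
  have hBc : IsCompact B := isCompact_Icc.prod (isCompact_Icc.prod isCompact_Icc)
  have hcont : Continuous fun q : ℝ × (ℝ × ℝ) =>
      (4 * Real.pi)⁻¹ * a * ‖gamS q.2‖ * (sph a q.2).1 := by
    have := continuous_gamS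
    have := continuous_sph a
    fun_prop
  have hbound : Integrable (B.indicator fun q : ℝ × (ℝ × ℝ) =>
      (4 * Real.pi)⁻¹ * a * ‖gamS q.2‖ * (sph a q.2).1)
      ((volume.restrict (Ioo (-Real.pi) Real.pi)).prod (volume.restrict strip)) := by
    rw [Measure.prod_restrict]
    exact ((integrable_indicator_iff hBm).2 (hcont.continuousOn.integrableOn_compact hBc)).restrict
  refine hbound.mono' (hj.ennreal_toReal.smul (hmeas.comp hmp.measurable)).aestronglyMeasurable ?_
  rw [Measure.prod_restrict]
  refine (ae_restrict_iff' (measurableSet_Ioo.prod measurableSet_strip)).2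
    (Eventually.of_forall fun q hq => ?_)
  have hsin : 0 ≤ (4 * Real.pi)⁻¹ * a * ‖gamS q.2‖ * (sph a q.2).1 := by
    have := (sph_fst_pos ha hq.2).le
    have := Real.pi_pos
    positivity
  simp only [Function.comp_apply]
  rw [ENNReal.toReal_ofReal (jac_nonneg ha hq.2)]
  by_cases hx : cylPoint e₁ e₂ n q.1 (sph a q.2) ∈ K
  · have hqB : q ∈ B := by
      refine ⟨Ioo_subset_Icc_self hq.1, ⟨(le_of_lt hq.2.1), ?_⟩, Ioo_subset_Icc_self hq.2.2⟩
      have h := (mul_sinh_le_norm_cylPoint he q.1 q.2).trans (hR _ hx)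
      rw [hS, ← Real.sinh_le_sinh, Real.sinh_arsinh, le_div_iff₀ ha]
      linarith
    rw [indicator_of_mem hx, indicator_of_mem hqB, norm_jac_mul_phi ha he q.1 hq.2]
  · rw [indicator_of_notMem hx, smul_zero, norm_zero]
    exact indicator_apply_nonneg fun _ => hsin

theorem norm_phiReg_le (ε : ℝ) (y x : R3) : ‖phiReg ε y x‖ ≤ ‖phi y x‖ := by
  unfold phiReg
  split_ifs
  · exact le_rfl
  · simp

theorem locallyIntegrable_phiReg {a : ℝ} (ha : 0 < a) {e₁ e₂ n : R3}
    (he : Orthonormal ℝ ![e₁, e₂, n]) (ε : ℝ) : LocallyIntegrable (phiReg ε (a • n)) :=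
  (locallyIntegrable_phi ha he).mono (measurable_phiReg ε _).aestronglyMeasurable
    (Eventually.of_forall fun x => norm_phiReg_le ε _ x)

/-- Where Re γ > 0, the regularized potential equals φ once ε is small; this gives pointwise
convergence almost everywhere. -/
theorem ae_gam_re_pos {a : ℝ} (ha : 0 < a) {e₁ e₂ n : R3}
    (he : Orthonormal ℝ ![e₁, e₂, n]) : ∀ᵐ x : R3, 0 < (gam (toC3 x (a • n))).re := by
  have hmp := measurePreserving_spheroidal ha he
  have hm : MeasurableSet {x : R3 | 0 < (gam (toC3 x (a • n))).re} :=
    measurableSet_lt measurable_const (Complex.measurable_re.comp (measurable_gam _))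
  rw [← hmp.map_eq, ae_map_iff hmp.measurable.aemeasurable hm]
  refine (withDensity_absolutelyContinuous _ _).ae_le ?_
  rw [Measure.prod_restrict]
  refine (ae_restrict_iff' (measurableSet_Ioo.prod measurableSet_strip)).2
    (Eventually.of_forall fun q hq => ?_)
  rw [gam_cylPoint ha he q.1 hq.2, Complex.re_ofReal_mul, gamS_re]
  exact mul_pos ha (Real.sinh_pos_iff.2 hq.2.1)

end Potential

/-! ### The flux functionals and Green's formula for the regularized potential -/

section Functionals

theorem meanFn_add (e₁ e₂ n : R3) {f g : R3 → ℂ} (hf : Continuous f) (hg : Continuous g) :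
    meanFn e₁ e₂ n (f + g) = meanFn e₁ e₂ n f + meanFn e₁ e₂ n g := by
  ext v
  have hc := (contDiff_cylPoint_angle e₁ e₂ n v (m := 0)).continuous
  have hfc : Continuous fun θ => f (cylPoint e₁ e₂ n θ v) := hf.comp hc
  have hgc : Continuous fun θ => g (cylPoint e₁ e₂ n θ v) := hg.comp hc
  simp only [Pi.add_apply, meanFn_eq]
  rw [intervalIntegral.integral_add (hfc.intervalIntegrable _ _) (hgc.intervalIntegrable _ _),
    smul_add]

theorem meanFn_smul (e₁ e₂ n : R3) (c : ℂ) (f : R3 → ℂ) :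
    meanFn e₁ e₂ n (c • f) = c • meanFn e₁ e₂ n f := by
  ext v
  simp only [Pi.smul_apply, meanFn_eq]
  rw [intervalIntegral.integral_smul, smul_comm]

theorem flux_add (a : ℝ) {G H : ℝ × ℝ → ℂ} (hG : ContDiff ℝ 1 G) (hH : ContDiff ℝ 1 H)
    (p : ℝ × ℝ) : flux a (G + H) p = flux a G p + flux a H p := by
  unfold flux
  rw [fderiv_add (hG.differentiable one_ne_zero _) (hH.differentiable one_ne_zero _), add_apply,
    Pi.add_apply]
  ring

theorem flux_smul (a : ℝ) (c : ℂ) {G : ℝ × ℝ → ℂ} (hG : ContDiff ℝ 1 G) (p : ℝ × ℝ) :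
    flux a (c • G) p = c * flux a G p := by
  unfold flux
  rw [fderiv_const_smul (hG.differentiable one_ne_zero _), smul_apply, Pi.smul_apply, smul_eq_mul,
    smul_eq_mul]
  ring

/-- The flux through the spheroid with parameter `s`, as a functional of the test function. -/
noncomputable def surfFunctional (a : ℝ) (e₁ e₂ n : R3) {s : ℝ} (hs : 0 < s) : C1 →ₗ[ℂ] ℂ where
  toFun f := surf a (meanFn e₁ e₂ n (f : R3 → ℂ)) s
  map_add' f g := by
    have hf : ContDiff ℝ 1 (f : R3 → ℂ) := f.2
    have hg : ContDiff ℝ 1 (g : R3 → ℂ) := g.2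
    have hf' := contDiff_meanFn e₁ e₂ n (m := 1) hf
    have hg' := contDiff_meanFn e₁ e₂ n (m := 1) hg
    have e : ((f + g : C1) : R3 → ℂ) = (f : R3 → ℂ) + g := rfl
    simp only [surf, e, meanFn_add e₁ e₂ n hf.continuous hg.continuous]
    simp only [flux_add a hf' hg']
    rw [intervalIntegral.integral_add ((continuous_flux a hf' hs).intervalIntegrable _ _)
      ((continuous_flux a hg' hs).intervalIntegrable _ _), mul_add]
  map_smul' c f := by
    have hf : ContDiff ℝ 1 (f : R3 → ℂ) := f.2
    have hf' := contDiff_meanFn e₁ e₂ n (m := 1) hf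
    have e : ((c • f : C1) : R3 → ℂ) = c • (f : R3 → ℂ) := rfl
    simp only [surf, e, meanFn_smul]
    simp only [flux_smul a c hf', intervalIntegral.integral_const_mul, RingHom.id_apply,
      smul_eq_mul]
    ring

theorem norm_surf_meanFn_le {a : ℝ} (ha : 0 ≤ a) {e₁ e₂ n : R3}
    (he : Orthonormal ℝ ![e₁, e₂, n]) {f : R3 → ℂ} (hf : ContDiff ℝ 1 f) {M R s : ℝ} (hs : 0 < s)
    (hM0 : 0 ≤ M) (hR : a * Real.cosh s ≤ R)
    (hM : ∀ x ∈ Metric.closedBall (0 : R3) (2 * R), ‖f x‖ ≤ M ∧ ‖fderiv ℝ f x‖ ≤ M) :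
    ‖surf a (meanFn e₁ e₂ n f) s‖ ≤ (2 * Real.pi * a * Real.cosh s ^ 2 + 1) * M :=
  norm_surf_le ha (contDiff_meanFn e₁ e₂ n (m := 1) hf) hs
    (fun _ hv => ⟨norm_meanFn_le he (fun x hx => (hM x hx).1) hv,
      norm_fderiv_meanFn_le he hf hM0 (fun x hx => (hM x hx).2) hv⟩) hR

theorem continuous_laplacian {f : R3 → ℂ} (hf : ContDiff ℝ 2 f) : Continuous (Δ f) := by
  have hc : Continuous (fderiv ℝ (fderiv ℝ f)) :=
    (contDiff_one_fderiv hf).continuous_fderiv one_ne_zero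
  rw [InnerProductSpace.laplacian_eq_iteratedFDeriv_stdOrthonormalBasis]
  simp only [iteratedFDeriv_two_apply]
  fun_prop

theorem hasCompactSupport_laplacian {f : R3 → ℂ} (hs : HasCompactSupport f) :
    HasCompactSupport (Δ f) := by
  refine ((hs.fderiv ℝ).fderiv ℝ).mono fun x hx h0 => hx ?_
  rw [InnerProductSpace.laplacian_eq_iteratedFDeriv_stdOrthonormalBasis]
  simp only [iteratedFDeriv_two_apply, h0]
  simp

theorem fderiv_eq_zero_of_notMem_tsupport {f : R3 → ℂ} {x : R3} (hx : x ∉ tsupport f) :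
    fderiv ℝ f x = 0 :=
  image_eq_zero_of_notMem_tsupport fun h => hx (tsupport_fderiv_subset ℝ h)

/-- Green's formula outside the spheroid `Re γ = ε`. -/
theorem integral_phiReg_mul_laplacian {a : ℝ} (ha : 0 < a) {e₁ e₂ n : R3}
    (he : Orthonormal ℝ ![e₁, e₂, n]) {ε : ℝ} (hε : 0 < ε) {f : R3 → ℂ} (hf : ContDiff ℝ 2 f)
    (hs : HasCompactSupport f) :
    ∫ x, phiReg ε (a • n) x * Δ f x = surf a (meanFn e₁ e₂ n f) (Real.arsinh (ε / a)) := by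
  have hf1 : ContDiff ℝ 1 f := hf.of_le one_le_two
  set s₀ := Real.arsinh (ε / a) with hs₀
  have hs₀pos : 0 < s₀ := Real.arsinh_pos_iff.2 (div_pos hε ha)
  have hlt : ∀ s, ε < a * Real.sinh s ↔ s₀ < s := by
    intro s
    rw [hs₀, ← Real.sinh_lt_sinh (y := s), Real.sinh_arsinh, div_lt_iff₀ ha, mul_comm]
  obtain ⟨R, hR⟩ := hs.isCompact.isBounded.exists_norm_le
  -- Spheroids beyond `S` lie outside the support of `f`; the maximum ensures `s₀ ≤ S` even when the
  -- support lies inside the inner spheroid.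
  set S := max s₀ (Real.arsinh ((R + 1) / a)) with hSdef
  have hfar : ∀ θ (p : ℝ × ℝ), S ≤ p.1 → cylPoint e₁ e₂ n θ (sph a p) ∉ tsupport f := by
    intro θ p hp hmem
    have h1 := hR _ hmem
    have h2 := mul_sinh_le_norm_cylPoint (a := a) he θ p
    have h3 : (R + 1) / a ≤ Real.sinh p.1 := by
      rw [← Real.sinh_arsinh ((R + 1) / a)]
      exact Real.sinh_le_sinh.2 ((le_max_right _ _).trans hp)
    rw [div_le_iff₀ ha] at h3
    linarith
  have hΔ0 : ∀ x, x ∉ tsupport f → Δ f x = 0 := by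
    intro x hx
    have : fderiv ℝ (fderiv ℝ f) x = 0 := image_eq_zero_of_notMem_tsupport fun h =>
      hx (tsupport_fderiv_subset ℝ (tsupport_fderiv_subset ℝ h))
    rw [laplacian_eq_of_orthonormal he, this]
    simp
  have hint : Integrable fun x => phiReg ε (a • n) x * Δ f x := by
    refine ((locallyIntegrable_phiReg ha he ε).integrable_smul_left_of_hasCompactSupport
      (continuous_laplacian hf) (hasCompactSupport_laplacian hs)).congr
      (Eventually.of_forall fun x => ?_)
    simp [mul_comm]
  have hflux : ∀ τ, flux a (meanFn e₁ e₂ n f) (S, τ) = 0 := by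
    intro τ
    have h1 : meanFn e₁ e₂ n f (sph a (S, τ)) = 0 := by
      rw [meanFn_eq]
      simp [fun θ => image_eq_zero_of_notMem_tsupport (hfar θ (S, τ) le_rfl)]
    have h2 : fderiv ℝ (meanFn e₁ e₂ n f) (sph a (S, τ)) (sphS a (S, τ)) = 0 := by
      rw [fderiv_meanFn e₁ e₂ n hf1]
      simp [fun θ => fderiv_eq_zero_of_notMem_tsupport (hfar θ (S, τ) le_rfl)]
    simp [flux, h1, h2]
  set A : Set (ℝ × ℝ) := Ioc s₀ S ×ˢ univ with hA
  have hAm : MeasurableSet A := measurableSet_Ioc.prod MeasurableSet.univ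
  -- The constant: 2π · a²|w|²ρ · (-1/(4π a w)) = -½ · (a|w|²/w) · ρ, and ρ times the mean of Δf is
  -- the bracket in `fluxDiv`.
  have hpt : ∀ p ∈ strip, (2 * Real.pi * jac a p : ℝ) *
      meanFn e₁ e₂ n (fun x => phiReg ε (a • n) x * Δ f x) (sph a p) =
      A.indicator (fun p => (-1 / 2 : ℂ) * fluxDiv a (meanFn e₁ e₂ n f) p) p := by
    intro p hp
    have hgam := fun θ => gam_cylPoint ha he θ hp
    have hre : ((a : ℂ) * gamS p).re = a * Real.sinh p.1 := by
      rw [Complex.re_ofReal_mul, gamS_re]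
    by_cases hpS : p.1 ≤ S
    · by_cases hps : s₀ < p.1
      · have hw : gamS p ≠ 0 := gamS_ne_zero hp.1
        have hm : meanFn e₁ e₂ n (fun x => phiReg ε (a • n) x * Δ f x) (sph a p) =
            -1 / (4 * (Real.pi : ℂ) * (a * gamS p)) * meanFn e₁ e₂ n (Δ f) (sph a p) := by
          have h0 : ∀ θ, phiReg ε (a • n) (cylPoint e₁ e₂ n θ (sph a p)) =
              -1 / (4 * (Real.pi : ℂ) * (a * gamS p)) := by
            intro θ
            rw [phiReg, hgam θ, hre, if_pos ((hlt _).2 hps), phi, hgam θ]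
          rw [meanFn_eq, meanFn_eq]
          simp only [h0]
          rw [intervalIntegral.integral_const_mul, mul_smul_comm]
        rw [indicator_of_mem (show p ∈ A from ⟨⟨hps, hpS⟩, mem_univ _⟩), hm]
        have hl := mul_meanFn_laplacian he hf (sph a p)
        have hpi : (Real.pi : ℂ) ≠ 0 := by exact_mod_cast Real.pi_ne_zero
        have ha' : (a : ℂ) ≠ 0 := by exact_mod_cast ha.ne'
        rw [fluxDiv, ← hl, jac]
        simp only [Complex.ofReal_mul, Complex.ofReal_add, Complex.ofReal_pow,
          Complex.ofReal_ofNat]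
        field_simp
        ring
      · rw [indicator_of_notMem (fun h => hps h.1.1), meanFn_eq]
        have h0 : ∀ θ, phiReg ε (a • n) (cylPoint e₁ e₂ n θ (sph a p)) = 0 := by
          intro θ
          rw [phiReg, hgam θ, hre, if_neg]
          rwa [hlt]
        simp [h0]
    · rw [indicator_of_notMem (fun h => hpS h.1.2), meanFn_eq]
      simp [fun θ => hΔ0 _ (hfar θ p (le_of_not_ge hpS))]
  rw [integral_eq_integral_strip ha he hint, setIntegral_congr_fun measurableSet_strip hpt,
    setIntegral_indicator hAm, integral_const_mul]
  have hset : (strip ∩ A : Set (ℝ × ℝ)) =ᵐ[volume]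
      (Icc s₀ S ×ˢ Icc (-(Real.pi / 2)) (Real.pi / 2) : Set (ℝ × ℝ)) := by
    have e : strip ∩ A = Ioc s₀ S ×ˢ Ioo (-(Real.pi / 2)) (Real.pi / 2) := by
      rw [strip, hA, prod_inter_prod, inter_univ, inter_eq_self_of_subset_right]
      exact fun x hx => hs₀pos.trans hx.1
    rw [e]
    exact Measure.set_prod_ae_eq Ioc_ae_eq_Icc Ioo_ae_eq_Icc
  rw [setIntegral_congr_set hset, integral_fluxDiv a (contDiff_meanFn e₁ e₂ n (m := 2) hf) hs₀pos
    (le_max_left _ _) hflux, surf]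
  ring

end Functionals

/-! ### Integrals over the disk and the explicit forms of L₁ and L₂ -/

section DiskIntegrals

theorem image_mul_sin {a : ℝ} (ha : 0 < a) :
    (fun τ => a * Real.sin τ) '' Ioo 0 (Real.pi / 2) = Ioo 0 a := by
  have hpi := Real.pi_pos
  ext q
  constructor
  · rintro ⟨τ, hτ, rfl⟩
    have h1 : 0 < Real.sin τ := Real.sin_pos_of_pos_of_lt_pi hτ.1 (by linarith [hτ.2])
    have h2 : 0 < Real.cos τ := Real.cos_pos_of_mem_Ioo ⟨by linarith [hτ.1], hτ.2⟩
    have h3 : Real.sin τ < 1 := by nlinarith [Real.sin_sq_add_cos_sq τ]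
    exact ⟨by positivity, by simpa using mul_lt_mul_of_pos_left h3 ha⟩
  · intro hq
    have h1 : 0 < q / a := div_pos hq.1 ha
    have h2 : q / a < 1 := (div_lt_one ha).2 hq.2
    refine ⟨Real.arcsin (q / a), ⟨Real.arcsin_pos.2 h1, Real.arcsin_lt_pi_div_two.2 h2⟩, ?_⟩
    simp only
    rw [Real.sin_arcsin (by linarith) h2.le]
    field_simp

theorem image_mul_cos {a : ℝ} (ha : 0 < a) :
    (fun τ => a * Real.cos τ) '' Ioo 0 (Real.pi / 2) = Ioo 0 a := by
  rw [← image_mul_sin ha]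
  have key : ∀ τ ∈ Ioo 0 (Real.pi / 2), Real.pi / 2 - τ ∈ Ioo 0 (Real.pi / 2) :=
    fun τ hτ => ⟨by linarith [hτ.2], by linarith [hτ.1]⟩
  ext q
  constructor
  · rintro ⟨τ, hτ, rfl⟩
    exact ⟨_, key τ hτ, by simp [Real.sin_pi_div_two_sub]⟩
  · rintro ⟨τ, hτ, rfl⟩
    exact ⟨_, key τ hτ, by simp [Real.cos_pi_div_two_sub]⟩

theorem sin_pos_of_mem {τ : ℝ} (hτ : τ ∈ Ioo 0 (Real.pi / 2)) : 0 < Real.sin τ :=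
  Real.sin_pos_of_pos_of_lt_pi hτ.1 (by linarith [hτ.2, Real.pi_pos])

theorem cos_pos_of_mem {τ : ℝ} (hτ : τ ∈ Ioo 0 (Real.pi / 2)) : 0 < Real.cos τ :=
  Real.cos_pos_of_mem_Ioo ⟨by linarith [hτ.1, Real.pi_pos], hτ.2⟩

/-- Integrability is read off in the angle τ, so absolute convergence and the value of the integral
come out together. -/
theorem integral_subst_sin {a : ℝ} (ha : 0 < a) {g k : ℝ → ℂ}
    (hk : IntegrableOn k (Ioo 0 (Real.pi / 2)))
    (h : ∀ τ ∈ Ioo 0 (Real.pi / 2), ((a * Real.cos τ : ℝ) : ℂ) * g (a * Real.sin τ) = k τ) :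
    IntervalIntegrable g volume 0 a ∧
      ∫ q in (0 : ℝ)..a, g q = ∫ τ in Ioo 0 (Real.pi / 2), k τ := by
  have hd : ∀ τ ∈ Ioo 0 (Real.pi / 2),
      HasDerivWithinAt (fun τ => a * Real.sin τ) (a * Real.cos τ) (Ioo 0 (Real.pi / 2)) τ :=
    fun τ _ => ((Real.hasDerivAt_sin τ).const_mul a).hasDerivWithinAt
  have hinj : InjOn (fun τ => a * Real.sin τ) (Ioo 0 (Real.pi / 2)) := by
    intro x hx y hy hxy
    have hpi := Real.pi_pos
    exact Real.injOn_sin ⟨by linarith [hx.1], hx.2.le⟩ ⟨by linarith [hy.1], hy.2.le⟩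
      (mul_left_cancel₀ ha.ne' hxy)
  have he : EqOn (fun τ => |a * Real.cos τ| • g (a * Real.sin τ)) k (Ioo 0 (Real.pi / 2)) := by
    intro τ hτ
    simp only
    rw [abs_of_pos (mul_pos ha (cos_pos_of_mem hτ)), Complex.real_smul, h τ hτ]
  rw [intervalIntegrable_iff_integrableOn_Ioo_of_le ha.le,
    intervalIntegral.integral_of_le ha.le, integral_Ioc_eq_integral_Ioo, ← image_mul_sin ha,
    integrableOn_image_iff_integrableOn_abs_deriv_smul measurableSet_Ioo hd hinj,
    integral_image_eq_integral_abs_deriv_smul measurableSet_Ioo hd hinj,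
    integrableOn_congr_fun he measurableSet_Ioo, setIntegral_congr_fun measurableSet_Ioo he]
  exact ⟨hk, rfl⟩

theorem integral_subst_cos {a : ℝ} (ha : 0 < a) {g k : ℝ → ℂ}
    (hk : IntegrableOn k (Ioo 0 (Real.pi / 2)))
    (h : ∀ τ ∈ Ioo 0 (Real.pi / 2), ((a * Real.sin τ : ℝ) : ℂ) * g (a * Real.cos τ) = k τ) :
    IntervalIntegrable g volume 0 a ∧
      ∫ q in (0 : ℝ)..a, g q = ∫ τ in Ioo 0 (Real.pi / 2), k τ := by
  have hd : ∀ τ ∈ Ioo 0 (Real.pi / 2),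
      HasDerivWithinAt (fun τ => a * Real.cos τ) (a * -Real.sin τ) (Ioo 0 (Real.pi / 2)) τ :=
    fun τ _ => ((Real.hasDerivAt_cos τ).const_mul a).hasDerivWithinAt
  have hinj : InjOn (fun τ => a * Real.cos τ) (Ioo 0 (Real.pi / 2)) := by
    intro x hx y hy hxy
    have hpi := Real.pi_pos
    exact Real.injOn_cos ⟨hx.1.le, by linarith [hx.2]⟩ ⟨hy.1.le, by linarith [hy.2]⟩
      (mul_left_cancel₀ ha.ne' hxy)
  have he : EqOn (fun τ => |a * -Real.sin τ| • g (a * Real.cos τ)) k (Ioo 0 (Real.pi / 2)) := by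
    intro τ hτ
    simp only
    rw [mul_neg, abs_neg, abs_of_pos (mul_pos ha (sin_pos_of_mem hτ)), Complex.real_smul, h τ hτ]
  rw [intervalIntegrable_iff_integrableOn_Ioo_of_le ha.le,
    intervalIntegral.integral_of_le ha.le, integral_Ioc_eq_integral_Ioo, ← image_mul_cos ha,
    integrableOn_image_iff_integrableOn_abs_deriv_smul measurableSet_Ioo hd hinj,
    integral_image_eq_integral_abs_deriv_smul measurableSet_Ioo hd hinj,
    integrableOn_congr_fun he measurableSet_Ioo, setIntegral_congr_fun measurableSet_Ioo he]
  exact ⟨hk, rfl⟩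

/-- The difference kernel on the disk in the angle `τ`. -/
noncomputable def diffKernel (a : ℝ) (G : ℝ × ℝ → ℂ) (τ : ℝ) : ℂ :=
  (Real.cos τ : ℂ) * (G (a * Real.cos τ, 0) - G (a, 0)) / (Real.sin τ : ℂ) ^ 2

/-- The normal derivative kernel on the disk in the angle `τ`. -/
noncomputable def normalKernel (a : ℝ) (G : ℝ × ℝ → ℂ) (τ : ℝ) : ℂ :=
  ((a * Real.cos τ : ℝ) : ℂ) * fderiv ℝ G (a * Real.cos τ, 0) (0, 1)

/-- At s = 0 the point is (a cos τ, 0), its s-derivative is (0, a sin τ) and w = i sin τ. Hence w² =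
-sin² τ gives the sign of the difference term and 1/i = -i the factor of the normal term. -/
theorem fluxReg_zero (a : ℝ) (G : ℝ × ℝ → ℂ) {τ : ℝ} (hτ : Real.sin τ ≠ 0) :
    fluxReg a G (0, τ) = -diffKernel a G τ - Complex.I * normalKernel a G τ := by
  have h1 : sph a (0, τ) = (a * Real.cos τ, 0) := by simp [sph]
  have h2 : sphS a (0, τ) = (a * Real.sin τ) • ((0 : ℝ), (1 : ℝ)) := by simp [sphS]
  have h3 : gamS (0, τ) = Complex.I * (Real.sin τ : ℂ) := by simp [gamS]
  have hs : (Real.sin τ : ℂ) ≠ 0 := by exact_mod_cast hτ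
  rw [fluxReg, diffKernel, normalKernel, h1, h2, h3, map_smul, Complex.real_smul]
  simp only [Real.cosh_zero, one_mul, one_pow, Complex.ofReal_mul]
  have hI : Complex.I ≠ 0 := Complex.I_ne_zero
  generalize (Real.sin τ : ℂ) = t at *
  field_simp
  rw [Complex.I_sq]
  ring_nf

theorem fluxReg_zero_neg (a : ℝ) (G : ℝ × ℝ → ℂ) (τ : ℝ) :
    fluxReg a G (0, -τ) = fluxReg a G (0, τ) := by
  have h1 : sph a (0, -τ) = sph a (0, τ) := by simp [sph]
  have h2 : sphS a (0, -τ) = -sphS a (0, τ) := by simp [sphS]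
  have h3 : gamS (0, -τ) = -gamS (0, τ) := by simp [gamS]
  simp only [fluxReg, h1, h2, h3, Real.cos_neg, map_neg, neg_sq]
  rw [div_neg, neg_mul_neg]

theorem measurable_fluxReg (a : ℝ) {G : ℝ × ℝ → ℂ} (hG : ContDiff ℝ 1 G) :
    Measurable (fluxReg a G) := by
  have h1 : Measurable fun p => fderiv ℝ G (sph a p) (sphS a p) :=
    (((hG.continuous_fderiv one_ne_zero).comp (continuous_sph a)).clm_apply
      (continuous_sphS a)).measurable
  have h2 : Measurable fun p => G (sph a p) := (hG.continuous.comp (continuous_sph a)).measurable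
  have h3 := continuous_gamS.measurable
  have h4 : Measurable fun p : ℝ × ℝ => ((Real.cosh p.1 * Real.cos p.2 : ℝ) : ℂ) :=
    Continuous.measurable (by fun_prop)
  have h5 : Measurable fun p : ℝ × ℝ => ((Real.cosh p.1 ^ 2 * Real.cos p.2 : ℝ) : ℂ) :=
    Continuous.measurable (by fun_prop)
  exact ((h4.div h3).mul h1).add ((h5.div (h3.pow_const 2)).mul (h2.sub_const _))

theorem intervalIntegrable_fluxReg_zero {a : ℝ} (ha : 0 ≤ a) {G : ℝ × ℝ → ℂ}
    (hG : ContDiff ℝ 1 G) :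
    IntervalIntegrable (fun τ => fluxReg a G (0, τ)) volume (-(Real.pi / 2)) (Real.pi / 2) := by
  obtain ⟨M, hM⟩ := (isCompact_closedBall (0 : ℝ × ℝ) (a * Real.cosh 0)
    ).exists_bound_of_continuousOn (hG.continuous_fderiv one_ne_zero).continuousOn
  rw [intervalIntegrable_iff]
  refine Measure.integrableOn_of_bounded (M := 2 * a * Real.cosh 0 ^ 2 * M)
    (by simp [uIoc]) ?_ ?_
  · exact ((measurable_fluxReg a hG).comp measurable_prodMk_left).aestronglyMeasurable
  · refine (ae_restrict_iff' measurableSet_uIoc).2 (Eventually.of_forall fun τ hτ => ?_)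
    exact norm_fluxReg_le ha hG (fun v hv => hM v (mem_closedBall_zero_iff.2 hv))
      (p := (0, τ)) (cos_nonneg_of_mem_uIoc hτ) le_rfl

theorem integrableOn_normalKernel (a : ℝ) {G : ℝ × ℝ → ℂ} (hG : ContDiff ℝ 1 G) :
    IntegrableOn (normalKernel a G) (Ioo 0 (Real.pi / 2)) := by
  have hc1 := hG.continuous_fderiv one_ne_zero
  have hc : Continuous (normalKernel a G) := by
    unfold normalKernel
    fun_prop
  exact (hc.continuousOn.integrableOn_compact isCompact_Icc).mono_set Ioo_subset_Icc_self

theorem integrableOn_fluxReg_zero {a : ℝ} (ha : 0 ≤ a) {G : ℝ × ℝ → ℂ} (hG : ContDiff ℝ 1 G) :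
    IntegrableOn (fun τ => fluxReg a G (0, τ)) (Ioo 0 (Real.pi / 2)) := by
  have hpi := Real.pi_pos
  have h := (intervalIntegrable_iff_integrableOn_Ioo_of_le (by linarith)).1
    (intervalIntegrable_fluxReg_zero ha hG)
  exact h.mono_set (Ioo_subset_Ioo_left (by linarith))

/-- The singularity 1/sin² τ at the rim is handled by solving `fluxReg_zero` for this kernel: the
regularized flux is bounded and the normal kernel continuous. -/
theorem integrableOn_diffKernel {a : ℝ} (ha : 0 ≤ a) {G : ℝ × ℝ → ℂ} (hG : ContDiff ℝ 1 G) :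
    IntegrableOn (diffKernel a G) (Ioo 0 (Real.pi / 2)) := by
  refine ((integrableOn_fluxReg_zero ha hG).neg.sub
    ((integrableOn_normalKernel a hG).const_mul Complex.I)).congr_fun (fun τ hτ => ?_)
    measurableSet_Ioo
  simp only [Pi.sub_apply, Pi.neg_apply]
  rw [fluxReg_zero a G (sin_pos_of_mem hτ).ne']
  ring

theorem half_integral_fluxReg_zero {a : ℝ} (ha : 0 ≤ a) {G : ℝ × ℝ → ℂ} (hG : ContDiff ℝ 1 G) :
    (1 / 2 : ℂ) * (∫ τ in (-(Real.pi / 2))..(Real.pi / 2), fluxReg a G (0, τ)) =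
      -(∫ τ in Ioo 0 (Real.pi / 2), diffKernel a G τ) -
        Complex.I * ∫ τ in Ioo 0 (Real.pi / 2), normalKernel a G τ := by
  have hpi := Real.pi_pos
  have hi := intervalIntegrable_fluxReg_zero ha hG
  have hsub1 : uIcc (-(Real.pi / 2)) 0 ⊆ uIcc (-(Real.pi / 2)) (Real.pi / 2) :=
    uIcc_subset_uIcc_left (by rw [uIcc_of_le (by linarith)]; constructor <;> linarith)
  have hsub2 : uIcc 0 (Real.pi / 2) ⊆ uIcc (-(Real.pi / 2)) (Real.pi / 2) :=
    uIcc_subset_uIcc_right (by rw [uIcc_of_le (by linarith)]; constructor <;> linarith)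
  have hneg : ∫ τ in (-(Real.pi / 2))..0, fluxReg a G (0, τ) =
      ∫ τ in (0 : ℝ)..(Real.pi / 2), fluxReg a G (0, τ) := by
    have h := intervalIntegral.integral_comp_neg (a := 0) (b := Real.pi / 2)
      (fun τ => fluxReg a G (0, τ))
    simp only [fluxReg_zero_neg, neg_zero] at h
    exact h.symm
  have hdiff : IntegrableOn (fun τ => -diffKernel a G τ) (Ioo 0 (Real.pi / 2)) :=
    (integrableOn_diffKernel ha hG).neg
  rw [← intervalIntegral.integral_add_adjacent_intervals (hi.mono_set hsub1) (hi.mono_set hsub2),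
    hneg, intervalIntegral.integral_of_le (by linarith), integral_Ioc_eq_integral_Ioo,
    setIntegral_congr_fun measurableSet_Ioo
      fun τ hτ => fluxReg_zero a G (sin_pos_of_mem hτ).ne',
    integral_sub hdiff ((integrableOn_normalKernel a hG).const_mul Complex.I), integral_neg, integral_const_mul]
  ring

section ExplicitForms

variable {a : ℝ} {e₁ e₂ n : R3} {f : R3 → ℂ}

theorem oblMean_eq (p q : ℝ) : oblMean a e₁ e₂ n f p q =
    meanFn e₁ e₂ n f (√(a ^ 2 + p ^ 2) * √(a ^ 2 - q ^ 2) / a, p * q / a) := rfl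

theorem oblMean_zero (ha : 0 < a) (q : ℝ) :
    oblMean a e₁ e₂ n f 0 q = meanFn e₁ e₂ n f (√(a ^ 2 - q ^ 2), 0) := by
  rw [oblMean_eq]
  congr 2
  · rw [zero_pow two_ne_zero, add_zero, Real.sqrt_sq ha.le]
    field_simp
  · simp

theorem oblMean_zero_zero (ha : 0 < a) :
    oblMean a e₁ e₂ n f 0 0 = meanFn e₁ e₂ n f (a, 0) := by
  rw [oblMean_zero ha, zero_pow two_ne_zero, sub_zero, Real.sqrt_sq ha.le]

theorem sqrt_sq_sub_sin (ha : 0 < a) {τ : ℝ} (hτ : τ ∈ Ioo 0 (Real.pi / 2)) :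
    √(a ^ 2 - (a * Real.sin τ) ^ 2) = a * Real.cos τ := by
  have hc := cos_pos_of_mem hτ
  rw [show a ^ 2 - (a * Real.sin τ) ^ 2 = (a * Real.cos τ) ^ 2 by
    rw [mul_pow, mul_pow, Real.cos_sq']; ring, Real.sqrt_sq (by positivity)]

theorem sqrt_sq_sub_cos (ha : 0 < a) {τ : ℝ} (hτ : τ ∈ Ioo 0 (Real.pi / 2)) :
    √(a ^ 2 - (a * Real.cos τ) ^ 2) = a * Real.sin τ := by
  have hs := sin_pos_of_mem hτ
  rw [show a ^ 2 - (a * Real.cos τ) ^ 2 = (a * Real.sin τ) ^ 2 by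
    rw [mul_pow, mul_pow, Real.cos_sq']; ring, Real.sqrt_sq (by positivity)]

/-- ρ depends on p only through p², so it is stationary at p = 0 and only ζ moves, at rate q/a. This
factor q cancels the denominator in L₂. -/
theorem hasDerivAt_oblMean (ha : 0 < a) (hf : ContDiff ℝ 1 f) (q : ℝ) :
    HasDerivAt (fun p => oblMean a e₁ e₂ n f p q)
      (((q / a : ℝ) : ℂ) * fderiv ℝ (meanFn e₁ e₂ n f) (√(a ^ 2 - q ^ 2), 0) (0, 1)) 0 := by
  have h1 : HasDerivAt (fun p : ℝ => √(a ^ 2 + p ^ 2)) 0 0 := by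
    have h := ((hasDerivAt_pow 2 (0 : ℝ)).const_add (a ^ 2)).sqrt (by positivity)
    simpa using h
  have h2 : HasDerivAt (fun p : ℝ =>
      (√(a ^ 2 + p ^ 2) * √(a ^ 2 - q ^ 2) / a, p * q / a)) ((0 : ℝ), q / a) 0 := by
    have h3 := (h1.mul_const (√(a ^ 2 - q ^ 2))).div_const a
    have h4 := ((hasDerivAt_id (0 : ℝ)).mul_const q).div_const a
    simpa using h3.prodMk h4
  have hd := ((contDiff_meanFn e₁ e₂ n (m := 1) hf).differentiable (by simp)
    (√(a ^ 2 + 0 ^ 2) * √(a ^ 2 - q ^ 2) / a, 0 * q / a)).hasFDerivAt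
  have h := hd.comp_hasDerivAt (0 : ℝ) h2
  have e : (√(a ^ 2 + 0 ^ 2) * √(a ^ 2 - q ^ 2) / a, 0 * q / a) = (√(a ^ 2 - q ^ 2), (0 : ℝ)) := by
    rw [zero_pow two_ne_zero, add_zero, Real.sqrt_sq ha.le, zero_mul, zero_div]
    field_simp
  have e2 : ((0 : ℝ), q / a) = (q / a) • ((0 : ℝ), (1 : ℝ)) := by simp
  rw [e, e2, map_smul, Complex.real_smul] at h
  exact h

theorem hasDerivAt_cylMean (hf : ContDiff ℝ 1 f) (ρ : ℝ) :
    HasDerivAt (fun ζ => cylMean e₁ e₂ n f ρ ζ)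
      (fderiv ℝ (meanFn e₁ e₂ n f) (ρ, 0) (0, 1)) 0 := by
  have hd := ((contDiff_meanFn e₁ e₂ n (m := 1) hf).differentiable (by simp)
    (ρ, 0)).hasFDerivAt
  exact HasFDerivAt.comp_hasDerivAt (f := fun ζ : ℝ => (ρ, ζ)) (0 : ℝ) hd
    ((hasDerivAt_const (0 : ℝ) ρ).prodMk (hasDerivAt_id (0 : ℝ)))

theorem k1obl_subst (ha : 0 < a) (hf : ContDiff ℝ 1 f) :
    IntervalIntegrable (k1obl a e₁ e₂ n f) volume 0 a ∧
      ∫ q in (0 : ℝ)..a, k1obl a e₁ e₂ n f q =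
        ∫ τ in Ioo 0 (Real.pi / 2), (a : ℂ)⁻¹ * diffKernel a (meanFn e₁ e₂ n f) τ := by
  refine integral_subst_sin ha ((integrableOn_diffKernel ha.le
    (contDiff_meanFn e₁ e₂ n (m := 1) hf)).const_mul _) fun τ hτ => ?_
  have hs : (Real.sin τ : ℂ) ≠ 0 := by exact_mod_cast (sin_pos_of_mem hτ).ne'
  have ha' : (a : ℂ) ≠ 0 := by exact_mod_cast ha.ne'
  rw [k1obl, oblMean_zero_zero ha, oblMean_zero ha, sqrt_sq_sub_sin ha hτ, diffKernel]
  simp only [Complex.ofReal_mul]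
  field_simp

theorem k1cyl_subst (ha : 0 < a) (hf : ContDiff ℝ 1 f) :
    IntervalIntegrable (k1cyl a e₁ e₂ n f) volume 0 a ∧
      ∫ ρ in (0 : ℝ)..a, k1cyl a e₁ e₂ n f ρ =
        ∫ τ in Ioo 0 (Real.pi / 2), (a : ℂ)⁻¹ * diffKernel a (meanFn e₁ e₂ n f) τ := by
  refine integral_subst_cos ha ((integrableOn_diffKernel ha.le
    (contDiff_meanFn e₁ e₂ n (m := 1) hf)).const_mul _) fun τ hτ => ?_
  have hs0 := sin_pos_of_mem hτ
  have hs : (Real.sin τ : ℂ) ≠ 0 := by exact_mod_cast hs0.ne'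
  have ha' : (a : ℂ) ≠ 0 := by exact_mod_cast ha.ne'
  have hpow : (a ^ 2 - (a * Real.cos τ) ^ 2) ^ (3 / 2 : ℝ) = (a * Real.sin τ) ^ 3 := by
    rw [show a ^ 2 - (a * Real.cos τ) ^ 2 = (a * Real.sin τ) ^ (2 : ℝ) by
      rw [Real.rpow_two, mul_pow, mul_pow, Real.cos_sq']; ring,
      ← Real.rpow_mul (by positivity), ← Real.rpow_natCast]
    norm_num
  rw [k1cyl, hpow, diffKernel, meanFn, meanFn]
  simp only [Complex.ofReal_mul, Complex.ofReal_pow]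
  field_simp

theorem k2obl_subst (ha : 0 < a) (hf : ContDiff ℝ 1 f) :
    IntervalIntegrable (k2obl a e₁ e₂ n f) volume 0 a ∧
      ∫ q in (0 : ℝ)..a, k2obl a e₁ e₂ n f q =
        ∫ τ in Ioo 0 (Real.pi / 2), (a : ℂ)⁻¹ * normalKernel a (meanFn e₁ e₂ n f) τ := by
  refine integral_subst_sin ha ((integrableOn_normalKernel a
    (contDiff_meanFn e₁ e₂ n (m := 1) hf)).const_mul _) fun τ hτ => ?_
  have hs : (Real.sin τ : ℂ) ≠ 0 := by exact_mod_cast (sin_pos_of_mem hτ).ne'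
  have ha' : (a : ℂ) ≠ 0 := by exact_mod_cast ha.ne'
  rw [k2obl, oblMeanP, (hasDerivAt_oblMean ha hf _).deriv, sqrt_sq_sub_sin ha hτ, normalKernel]
  simp only [Complex.ofReal_mul, Complex.ofReal_div]
  field_simp

theorem k2cyl_subst (ha : 0 < a) (hf : ContDiff ℝ 1 f) :
    IntervalIntegrable (k2cyl a e₁ e₂ n f) volume 0 a ∧
      ∫ ρ in (0 : ℝ)..a, k2cyl a e₁ e₂ n f ρ =
        ∫ τ in Ioo 0 (Real.pi / 2), normalKernel a (meanFn e₁ e₂ n f) τ := by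
  refine integral_subst_cos ha (integrableOn_normalKernel a
    (contDiff_meanFn e₁ e₂ n (m := 1) hf)) fun τ hτ => ?_
  have hs : (Real.sin τ : ℂ) ≠ 0 := by exact_mod_cast (sin_pos_of_mem hτ).ne'
  have ha' : (a : ℂ) ≠ 0 := by exact_mod_cast ha.ne'
  rw [k2cyl, cylMeanZ, (hasDerivAt_cylMean hf _).deriv, sqrt_sq_sub_cos ha hτ, normalKernel]
  simp only [Complex.ofReal_mul]
  field_simp

end ExplicitForms

end DiskIntegrals

/-! ### The singular source as limit of the regularized sources -/

section SingularSource

variable {a : ℝ} {e₁ e₂ n : R3}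

open Classical in
/-- The regularized source distributions. -/
noncomputable def regSource (a : ℝ) (e₁ e₂ n : R3) (ε : ℝ) : C1 →ₗ[ℂ] ℂ :=
  if h : 0 < Real.arsinh (ε / a) then surfFunctional a e₁ e₂ n h else 0

theorem arsinh_div_pos (ha : 0 < a) {ε : ℝ} (hε : 0 < ε) : 0 < Real.arsinh (ε / a) :=
  Real.arsinh_pos_iff.2 (div_pos hε ha)

theorem regSource_apply (ha : 0 < a) {ε : ℝ} (hε : 0 < ε) (f : C1) :
    regSource a e₁ e₂ n ε f = surf a (meanFn e₁ e₂ n (f : R3 → ℂ)) (Real.arsinh (ε / a)) := by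
  rw [regSource, dif_pos (arsinh_div_pos ha hε)]
  rfl

/-- The parameter `b` lets one compact set and one constant serve all small ε, so that the bound
survives the limit. -/
theorem norm_regSource_le (ha : 0 < a) (he : Orthonormal ℝ ![e₁, e₂, n]) {ε b : ℝ} (hε : 0 < ε)
    (hb : Real.arsinh (ε / a) ≤ b) (f : C1) {M : ℝ} (hM0 : 0 ≤ M)
    (hM : ∀ x ∈ Metric.closedBall (0 : R3) (2 * (a * Real.cosh b)),
      ‖(f : R3 → ℂ) x‖ ≤ M ∧ ‖fderiv ℝ (f : R3 → ℂ) x‖ ≤ M) :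
    ‖regSource a e₁ e₂ n ε f‖ ≤ (2 * Real.pi * a * Real.cosh b ^ 2 + 1) * M := by
  have hpos := arsinh_div_pos ha hε
  have hcosh : Real.cosh (Real.arsinh (ε / a)) ≤ Real.cosh b := by
    rw [Real.cosh_le_cosh, abs_of_pos hpos, abs_of_pos (hpos.trans_le hb)]
    exact hb
  have hpi := Real.pi_pos
  have hc := Real.cosh_pos (Real.arsinh (ε / a))
  rw [regSource_apply ha hε]
  refine (norm_surf_meanFn_le ha.le he f.2 hpos hM0 (by gcongr) hM).trans ?_
  gcongr

theorem isDistribLaplacian_regSource (ha : 0 < a) (he : Orthonormal ℝ ![e₁, e₂, n]) {ε : ℝ}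
    (hε : 0 < ε) : IsDistribLaplacian (phiReg ε (a • n)) (regSource a e₁ e₂ n ε) := by
  refine ⟨locallyIntegrable_phiReg ha he ε, ⟨_, isCompact_closedBall 0 _, _,
    fun f M hM0 hM => norm_regSource_le ha he hε le_rfl f hM0 hM⟩, fun f hf hs => ?_⟩
  rw [regSource_apply ha hε, integral_phiReg_mul_laplacian ha he hε (contDiff_infty.1 hf 2) hs]

theorem tendsto_arsinh_div (ha : 0 < a) :
    Tendsto (fun ε => Real.arsinh (ε / a)) (𝓝[>] 0) (𝓝[>] 0) := by
  refine tendsto_nhdsWithin_iff.2 ⟨?_, ?_⟩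
  · have hc : Continuous fun ε => Real.arsinh (ε / a) :=
      Real.continuous_arsinh.comp (continuous_id.div_const a)
    exact (hc.tendsto' 0 0 (by simp)).mono_left nhdsWithin_le_nhds
  · filter_upwards [self_mem_nhdsWithin] with ε hε using arsinh_div_pos ha hε

theorem tendsto_regSource (ha : 0 < a) (f : C1) :
    Tendsto (fun ε => regSource a e₁ e₂ n ε f) (𝓝[>] 0)
      (𝓝 (L0obl a e₁ e₂ n f + L1obl a e₁ e₂ n f + Complex.I * L2obl a e₁ e₂ n f)) := by
  have hf : ContDiff ℝ 1 (f : R3 → ℂ) := f.2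
  have hG := contDiff_meanFn e₁ e₂ n (m := 1) hf
  have h := (tendsto_surf ha.le hG).comp (tendsto_arsinh_div ha)
  have ha' : (a : ℂ) ≠ 0 := by exact_mod_cast ha.ne'
  have e : L0obl a e₁ e₂ n f + L1obl a e₁ e₂ n f + Complex.I * L2obl a e₁ e₂ n f =
      (1 / 2 : ℂ) * (∫ τ in (-(Real.pi / 2))..(Real.pi / 2),
        fluxReg a (meanFn e₁ e₂ n (f : R3 → ℂ)) (0, τ)) + meanFn e₁ e₂ n (f : R3 → ℂ) (a, 0) := by
    rw [half_integral_fluxReg_zero ha.le hG, L0obl, L1obl, L2obl, (k1obl_subst ha hf).2,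
      (k2obl_subst ha hf).2, oblMean_zero_zero ha, integral_const_mul, integral_const_mul]
    field_simp
    ring
  rw [e]
  refine h.congr' ?_
  filter_upwards [self_mem_nhdsWithin] with ε hε
  exact (regSource_apply ha hε f).symm

/-- The singular source distribution in a frame adapted to `y = a n`. -/
noncomputable def singularSource (ha : 0 < a) (e₁ e₂ n : R3) : C1 →ₗ[ℂ] ℂ :=
  linearMapOfTendsto
    (fun f : C1 => L0obl a e₁ e₂ n f + L1obl a e₁ e₂ n f + Complex.I * L2obl a e₁ e₂ n f)
    (fun ε : ℝ => regSource a e₁ e₂ n ε) (l := 𝓝[>] 0)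
    (tendsto_pi_nhds.2 fun f => tendsto_regSource ha f)

theorem singularSource_apply (ha : 0 < a) (f : C1) : singularSource ha e₁ e₂ n f =
    L0obl a e₁ e₂ n f + L1obl a e₁ e₂ n f + Complex.I * L2obl a e₁ e₂ n f := rfl

theorem isSingularSource_singularSource (ha : 0 < a) (he : Orthonormal ℝ ![e₁, e₂, n]) :
    IsSingularSource (a • n) (singularSource ha e₁ e₂ n) :=
  ⟨regSource a e₁ e₂ n, fun _ hε => isDistribLaplacian_regSource ha he hε,
    fun f => tendsto_regSource ha f⟩

theorem isBoundedC1_singularSource (ha : 0 < a) (he : Orthonormal ℝ ![e₁, e₂, n]) :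
    IsBoundedC1 (singularSource ha e₁ e₂ n) := by
  refine ⟨_, isCompact_closedBall (0 : R3) (2 * (a * Real.cosh 1)),
    2 * Real.pi * a * Real.cosh 1 ^ 2 + 1, fun f M hM0 hM => ?_⟩
  refine le_of_tendsto (tendsto_regSource (e₁ := e₁) (e₂ := e₂) (n := n) ha f).norm ?_
  have h1 : ∀ᶠ ε in 𝓝[>] 0, Real.arsinh (ε / a) < 1 :=
    ((tendsto_arsinh_div ha).mono_right nhdsWithin_le_nhds).eventually (Iio_mem_nhds one_pos)
  filter_upwards [h1, self_mem_nhdsWithin] with ε hε hε0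
  exact norm_regSource_le ha he hε0 hε.le f hM0 hM

/-- On smooth compactly supported `f` the functionals are ∫ φ_ε Δf, which tends to ∫ φ Δf by
domination with |φ Δf|; the limit is compared with the one already computed by fluxes. -/
theorem isDistribLaplacian_singularSource (ha : 0 < a) (he : Orthonormal ℝ ![e₁, e₂, n]) :
    IsDistribLaplacian (phi (a • n)) (singularSource ha e₁ e₂ n) := by
  refine ⟨locallyIntegrable_phi ha he, isBoundedC1_singularSource ha he, fun f hf hs => ?_⟩
  have hf2 : ContDiff ℝ 2 (f : R3 → ℂ) := contDiff_infty.1 hf 2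
  have hΔ := continuous_laplacian hf2
  have hlim : Tendsto (fun ε => ∫ x, phiReg ε (a • n) x * Δ (f : R3 → ℂ) x) (𝓝[>] 0)
      (𝓝 (∫ x, phi (a • n) x * Δ (f : R3 → ℂ) x)) := by
    refine tendsto_integral_filter_of_dominated_convergence
      (fun x => ‖phi (a • n) x * Δ (f : R3 → ℂ) x‖) ?_ ?_ ?_ ?_
    · exact Eventually.of_forall fun ε =>
        ((measurable_phiReg ε _).mul hΔ.measurable).aestronglyMeasurable
    · refine Eventually.of_forall fun ε => Eventually.of_forall fun x => ?_
      rw [norm_mul, norm_mul]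
      gcongr
      exact norm_phiReg_le ε _ x
    · refine (((locallyIntegrable_phi ha he).integrable_smul_left_of_hasCompactSupport
        hΔ (hasCompactSupport_laplacian hs)).congr
        (Eventually.of_forall fun x => ?_)).norm
      simp [mul_comm]
    · filter_upwards [ae_gam_re_pos ha he] with x hx
      refine tendsto_const_nhds.congr' ?_
      have h1 : ∀ᶠ ε in 𝓝[>] (0 : ℝ), ε < (gam (toC3 x (a • n))).re :=
        nhdsWithin_le_nhds (Iio_mem_nhds hx)
      filter_upwards [h1] with ε hε
      rw [phiReg, if_pos hε]
  refine tendsto_nhds_unique (tendsto_regSource (e₁ := e₁) (e₂ := e₂) (n := n) ha f)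
    (hlim.congr' ?_)
  filter_upwards [self_mem_nhdsWithin] with ε hε
  exact ((isDistribLaplacian_regSource ha he hε).2.2 f hf hs).symm

theorem L1obl_eq_L1cyl (ha : 0 < a) {f : R3 → ℂ} (hf : ContDiff ℝ 1 f) :
    L1obl a e₁ e₂ n f = L1cyl a e₁ e₂ n f := by
  rw [L1obl, L1cyl, (k1obl_subst ha hf).2, (k1cyl_subst ha hf).2]

theorem L2obl_eq_L2cyl (ha : 0 < a) {f : R3 → ℂ} (hf : ContDiff ℝ 1 f) :
    L2obl a e₁ e₂ n f = L2cyl a e₁ e₂ n f := by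
  have ha' : (a : ℂ) ≠ 0 := by exact_mod_cast ha.ne'
  rw [L2obl, L2cyl, (k2obl_subst ha hf).2, (k2cyl_subst ha hf).2, integral_const_mul]
  field_simp

theorem exists_frame {n : R3} (hn : ‖n‖ = 1) : ∃ e₁ e₂ : R3, Orthonormal ℝ ![e₁, e₂, n] := by
  have hv : Orthonormal ℝ (({2} : Set (Fin 3)).domRestrict fun _ => n) :=
    ⟨fun _ => hn, fun i j hij => absurd (Subsingleton.elim i j) hij⟩
  obtain ⟨b, hb⟩ := hv.exists_orthonormalBasis_extension_of_card_eq (by simp)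
  refine ⟨b 0, b 1, ?_⟩
  have e : ![b 0, b 1, n] = b := by
    ext1 i
    fin_cases i
    · rfl
    · rfl
    · exact (hb 2 rfl).symm
  rw [e]
  exact b.orthonormal

end SingularSource

end HoloPotential

theorem proposition3 (y : R3) (hy : y ≠ 0) :
    (∃! T : C1 →ₗ[ℂ] ℂ, IsSingularSource y T) ∧
    ∀ T : C1 →ₗ[ℂ] ℂ, IsSingularSource y T →
      IsBoundedC1 T ∧ IsDistribLaplacian (phi y) T ∧
      ∀ (a : ℝ) (n e₁ e₂ : R3), a = ‖y‖ → n = a⁻¹ • y → Orthonormal ℝ ![e₁, e₂, n] →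
        ∀ f : C1,
          -- the partial derivatives exist and all the integrals converge absolutely
          (∀ q ∈ Ioo 0 a, DifferentiableAt ℝ (fun p => oblMean a e₁ e₂ n f p q) 0) ∧
          (∀ ρ ∈ Ioo 0 a, DifferentiableAt ℝ (fun ζ => cylMean e₁ e₂ n f ρ ζ) 0) ∧
          IntervalIntegrable (k1obl a e₁ e₂ n f) volume 0 a ∧
          IntervalIntegrable (k1cyl a e₁ e₂ n f) volume 0 a ∧
          IntervalIntegrable (k2obl a e₁ e₂ n f) volume 0 a ∧
          IntervalIntegrable (k2cyl a e₁ e₂ n f) volume 0 a ∧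
          -- the action on `f`, and the two expressions of each of the three terms
          T f = L0obl a e₁ e₂ n f + L1obl a e₁ e₂ n f + Complex.I * L2obl a e₁ e₂ n f ∧
          L0obl a e₁ e₂ n f = L0cyl a e₁ e₂ n f ∧
          L1obl a e₁ e₂ n f = L1cyl a e₁ e₂ n f ∧
          L2obl a e₁ e₂ n f = L2cyl a e₁ e₂ n f := by
  have hy0 : 0 < ‖y‖ := norm_pos_iff.2 hy
  have hunit : ‖‖y‖⁻¹ • y‖ = 1 := by
    rw [norm_smul, norm_inv, norm_norm, inv_mul_cancel₀ hy0.ne']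
  have hyn : ‖y‖ • (‖y‖⁻¹ • y) = y := by rw [smul_smul, mul_inv_cancel₀ hy0.ne', one_smul]
  -- The functional is built anew in each frame adapted to `y`; uniqueness shows that all these
  -- constructions agree, so the formula may be read off in any frame.
  have hex : ∀ e₁ e₂ : R3, Orthonormal ℝ ![e₁, e₂, ‖y‖⁻¹ • y] →
      IsSingularSource y (singularSource hy0 e₁ e₂ (‖y‖⁻¹ • y)) ∧
        IsDistribLaplacian (phi y) (singularSource hy0 e₁ e₂ (‖y‖⁻¹ • y)) := by
    intro e₁ e₂ he
    have h1 := isSingularSource_singularSource hy0 he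
    have h2 := isDistribLaplacian_singularSource hy0 he
    rw [hyn] at h1 h2
    exact ⟨h1, h2⟩
  obtain ⟨u₁, u₂, hu⟩ := exists_frame hunit
  refine ⟨⟨_, (hex u₁ u₂ hu).1, fun T hT => hT.unique (hex u₁ u₂ hu).1⟩, fun T hT => ?_⟩
  have hTd : IsDistribLaplacian (phi y) T := by
    rw [hT.unique (hex u₁ u₂ hu).1]
    exact (hex u₁ u₂ hu).2
  refine ⟨hTd.2.1, hTd, ?_⟩
  rintro a n e₁ e₂ rfl rfl he f
  have hf : ContDiff ℝ 1 (f : R3 → ℂ) := f.2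
  refine ⟨fun q _ => (hasDerivAt_oblMean hy0 hf q).differentiableAt,
    fun ρ _ => (hasDerivAt_cylMean hf ρ).differentiableAt, (k1obl_subst hy0 hf).1,
    (k1cyl_subst hy0 hf).1, (k2obl_subst hy0 hf).1, (k2cyl_subst hy0 hf).1, ?_,
    oblMean_zero_zero hy0, L1obl_eq_L1cyl hy0 hf, L2obl_eq_L2cyl hy0 hf⟩
  rw [hT.unique (hex e₁ e₂ he).1, singularSource_apply]
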